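/- Let $n\ge 0$, and let $S$ be the spinor module in dimension $4n+2$, i.e. an irreducible complex representation $\rho$ of $\mathbb{C}l_{4n+2}=Cl_{4n+2,0}\otimes\mathbb{C}$ (generators $e_j$ with $e_j^2=-1$) with a Hermitian metric for which all $\rho(v)$, $v\in\mathbb{R}^{4n+2}$, are skew-adjoint, graded by $(-1)^{\deg}=i^{2n+1}\rho(e_1\cdots e_{4n+2})$. Regard $Spin^c_{4n+2}=\{[\mu,u]=u\otimes\mu : \mu\in Spin_{4n+2},\,u\in U(1)\}$ as a subgroup of the units of $\mathbb{C}l_{4n+2}$, with the character $z^2([\mu,u])=u^2$. Let $Cl_3$ be the real Clifford algebra generated by $e_1,\dots,e_{4n+2}$ with $e_j^2=-1$, by $\epsilon_1$ with $\epsilon_1^2=1$ and by $\eta_1,\eta_2$ with $\eta_k^2=(-1)^n$ (so $Cl_3=Cl_{4n+2,3}$ for $n$ even and $Cl_{4n+4,1}$ for $n$ odd). Let $Spin^c_{4n+2}$ act on $Cl_3$ through $\mathrm{Ad}\otimes z^2$: by $\mathrm{Ad}$ on the $e_j$, trivially on $\epsilon_1$, and by $z^2$ on $\langle\eta_1,\eta_2\rangle\cong\mathbb{C}$,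 where $\eta_1=1$, $\eta_2=i$. (a) There is a real representation $\tilde\rho$ of $Cl_3$ on $S$ which restricts to $\rho$ on $Cl_{4n+2,0}$, with $\tilde\rho(\epsilon_1)=(-1)^{\deg}$, and whose action map $Cl_3\times S\to S$ is $Spin^c_{4n+2}$-equivariant. (b) Let $X$ be a smooth Riemannian manifold of dimension $4n+2$, not necessarily compact, with a spin$^c$ structure with principal bundle $P$. Let $S(X)=P\times_{Spin^c_{4n+2}}S$ be its spinor bundle and $\mathcal{L}_X=P\times_{z^2}\mathbb{C}$ its determinant line bundle. Let $\mathcal{L}_{\mathcal{H}}\subset\mathrm{End}_{\mathbb{R}}(S(X))$ consist of the real endomorphisms that are symmetric (for $n$ even), respectively skew-symmetric (for $n$ odd), for the real inner product, of odd degree, and anti-commute with Clifford multiplication by tangent vectors. For every $\tilde\rho$ as in (a), the induced extended Clifford action $\tilde c_X\colon\mathcal{L}_X\to\mathrm{End}_{\mathbb{R}}(S(X))$, given in the local trivializations of $P$ by $\tilde\rho$ on $\langle\eta_1,\eta_2\rangle$, is complex linear and maps each fibre of $\mathcal{L}_X$ bijectively onto the fibre of $\mathcal{L}_{\mathcal{H}}$.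 For every $k\in\{0,1,2,\dots,\infty\}$, $h\mapsto\tilde c_X\circ h$ is a bijection from the $C^k$ sections of $\mathcal{L}_X$ to the $C^k$ sections of $\mathrm{End}_{\mathbb{R}}(S(X))$ with values in $\mathcal{L}_{\mathcal{H}}$. It preserves supports: the set of points where $\tilde c_X\circ h$ is not invertible is the zero set of $h$, and the closures of the sets where $h$ and $\tilde c_X\circ h$ are non-zero coincide. -/

import Mathlib

open scoped TensorProduct Manifold ContDiff Bundle

noncomputable section

namespace SpinCLine

/-! ### Clifford algebras and the group `Spin^c` -/

/-- Euclidean space `ℝ^m`. -/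
abbrev Euc (m : ℕ) : Type := EuclideanSpace ℝ (Fin m)

/-- The quadratic form `v ↦ -|v|²`, so that the generators `e_j` of its Clifford algebra satisfy
`e_j² = -1`. -/
def negForm (m : ℕ) : QuadraticForm ℝ (Euc m) :=
  -(LinearMap.BilinMap.toQuadraticMap (innerₗ (Euc m)))

/-- The real Clifford algebra `Cl_{m,0}`. -/
abbrev Cl (m : ℕ) : Type := CliffordAlgebra (negForm m)

/-- The complex Clifford algebra `Cl_{m,0} ⊗ ℂ`. -/
abbrev CCl (m : ℕ) : Type := ℂ ⊗[ℝ] Cl m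

/-- A vector, as an element of the complex Clifford algebra. -/
def vec (m : ℕ) : Euc m →ₗ[ℝ] CCl m :=
  (Algebra.TensorProduct.includeRight : Cl m →ₐ[ℝ] CCl m).toLinearMap ∘ₗ
    CliffordAlgebra.ι (negForm m)

/-- The group `Spin_m`. -/
abbrev Spin (m : ℕ) : Type := spinGroup (negForm m)

/-- The homomorphism `Spin_m × U(1) → (Cl_m ⊗ ℂ)ˣ`, `(μ, u) ↦ [μ, u] = u ⊗ μ`. -/
def spinCHom (m : ℕ) : Spin m × Circle →* (CCl m)ˣ where
  toFun p :=
    { val := (p.2 : ℂ) ⊗ₜ (p.1 : Cl m)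
      inv := ((p.2⁻¹ : Circle) : ℂ) ⊗ₜ ((p.1⁻¹ : Spin m) : Cl m)
      val_inv := by
        rw [Algebra.TensorProduct.tmul_mul_tmul, ← Circle.coe_mul, ← Submonoid.coe_mul,
          mul_inv_cancel, mul_inv_cancel]
        rfl
      inv_val := by
        rw [Algebra.TensorProduct.tmul_mul_tmul, ← Circle.coe_mul, ← Submonoid.coe_mul,
          inv_mul_cancel, inv_mul_cancel]
        rfl }
  map_one' := by
    ext
    rfl
  map_mul' p q := by
    ext
    simp [Algebra.TensorProduct.tmul_mul_tmul]

/-- The group `Spin^c_m`, as a subgroup of the units of the complex Clifford algebra. -/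
def SpinC (m : ℕ) : Subgroup (CCl m)ˣ := (spinCHom m).range

/-- The underlying element of the complex Clifford algebra. -/
def spinVal {m : ℕ} (l : SpinC m) : CCl m := ((l : (CCl m)ˣ) : CCl m)

/-- The element `[μ, u]` of `Spin^c_m`. -/
def spinMk {m : ℕ} (μ : Spin m) (u : Circle) : SpinC m := ⟨spinCHom m (μ, u), ⟨(μ, u), rfl⟩⟩

theorem spinVal_mk {m : ℕ} (μ : Spin m) (u : Circle) :
    spinVal (spinMk μ u) = (u : ℂ) ⊗ₜ[ℝ] (μ : Cl m) := rfl

theorem exists_rep {m : ℕ} (l : SpinC m) : ∃ p : Spin m × Circle, spinMk p.1 p.2 = l := by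
  obtain ⟨l, p, rfl⟩ := l
  exact ⟨p, rfl⟩

theorem spinVal_mul {m : ℕ} (l k : SpinC m) : spinVal (l * k) = spinVal l * spinVal k := rfl

theorem spinVal_one {m : ℕ} : spinVal (1 : SpinC m) = 1 := rfl

theorem spinVal_inv_mul {m : ℕ} (l : SpinC m) : spinVal l⁻¹ * spinVal l = 1 := by
  rw [← spinVal_mul, inv_mul_cancel, spinVal_one]

/-- The complex linear extension of the canonical anti-automorphism `star` of `Cl_m`. -/
def conjT (m : ℕ) : CCl m →ₗ[ℂ] CCl m :=
  TensorProduct.AlgebraTensorModule.map LinearMap.id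
    (CliffordAlgebra.reverse ∘ₗ (CliffordAlgebra.involute (Q := negForm m)).toLinearMap)

theorem mul_conjT_mk {m : ℕ} (μ : Spin m) (u : Circle) :
    spinVal (spinMk μ u) * conjT m (spinVal (spinMk μ u)) = algebraMap ℂ (CCl m) ((u : ℂ) ^ 2) := by
  have h : conjT m (spinVal (spinMk μ u)) = (u : ℂ) ⊗ₜ[ℝ] (star (μ : Cl m)) := rfl
  have h2 : (μ : Cl m) * star (μ : Cl m) = 1 := spinGroup.coe_mul_star_self μ
  rw [h, spinVal_mk, Algebra.TensorProduct.tmul_mul_tmul, h2, pow_two]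
  rfl

/-- The character `z² : Spin^c_m → U(1) ⊂ ℂ`, `[μ, u] ↦ u²`. -/
def detChar {m : ℕ} (l : SpinC m) : ℂ := ((exists_rep l).choose.2 : ℂ) ^ 2

theorem algebraMap_detChar {m : ℕ} (l : SpinC m) :
    algebraMap ℂ (CCl m) (detChar l) = spinVal l * conjT m (spinVal l) := by
  have h := mul_conjT_mk (exists_rep l).choose.1 (exists_rep l).choose.2
  rw [(exists_rep l).choose_spec] at h
  exact h.symm

theorem algebraMap_inj (m : ℕ) : Function.Injective (algebraMap ℂ (CCl m)) := by
  have : Nontrivial (Cl m) := inferInstance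
  have : Nontrivial (CCl m) := inferInstance
  exact (algebraMap ℂ (CCl m)).injective

theorem detChar_mk {m : ℕ} (μ : Spin m) (u : Circle) : detChar (spinMk μ u) = (u : ℂ) ^ 2 :=
  algebraMap_inj m (by rw [algebraMap_detChar, mul_conjT_mk])

theorem detChar_mul {m : ℕ} (l k : SpinC m) : detChar (l * k) = detChar l * detChar k := by
  obtain ⟨p, rfl⟩ := (exists_rep l)
  obtain ⟨q, rfl⟩ := (exists_rep k)
  have h : spinMk p.1 p.2 * spinMk q.1 q.2 = spinMk (p.1 * q.1) (p.2 * q.2) :=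
    Subtype.ext ((spinCHom m).map_mul p q).symm
  rw [h, detChar_mk, detChar_mk, detChar_mk, Circle.coe_mul, mul_pow]

theorem detChar_one {m : ℕ} : detChar (1 : SpinC m) = 1 := by
  have h : (1 : SpinC m) = spinMk 1 1 := Subtype.ext (spinCHom m).map_one.symm
  rw [h, detChar_mk]
  simp

theorem norm_detChar {m : ℕ} (l : SpinC m) : ‖detChar l‖ = 1 := by
  obtain ⟨p, rfl⟩ := (exists_rep l)
  rw [detChar_mk, norm_pow, Circle.norm_coe, one_pow]

/-- The left inverse of `vec`, extracting the real vector part. -/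
def vecPart (m : ℕ) : CCl m →ₗ[ℝ] Euc m :=
  (TensorProduct.lid ℝ (Euc m)).toLinearMap ∘ₗ
    TensorProduct.map Complex.reLm
      (ExteriorAlgebra.ιInv ∘ₗ (CliffordAlgebra.equivExterior (negForm m)).toLinearMap)

theorem vecPart_vec (m : ℕ) (v : Euc m) : vecPart m (vec m v) = v := by
  simp [vecPart, vec, ExteriorAlgebra.ι_leftInverse v]

/-- The adjoint representation of `Spin^c_m` on `ℝ^m`: `Ad λ v = λ v λ⁻¹`
(see `vec_Ad`). -/
def Ad {m : ℕ} (l : SpinC m) : Euc m →ₗ[ℝ] Euc m :=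
  vecPart m ∘ₗ (LinearMap.mulRight ℝ (spinVal l⁻¹)) ∘ₗ (LinearMap.mulLeft ℝ (spinVal l)) ∘ₗ vec m

theorem vec_Ad {m : ℕ} (l : SpinC m) (v : Euc m) :
    vec m (Ad l v) = spinVal l * vec m v * spinVal l⁻¹ := by
  suffices h : ∃ w, vec m w = spinVal l * vec m v * spinVal l⁻¹ by
    obtain ⟨w, hw⟩ := h
    have : Ad l v = w := by
      change vecPart m (spinVal l * vec m v * spinVal l⁻¹) = w
      rw [← hw, vecPart_vec]
    rw [this, hw]
  obtain ⟨p, rfl⟩ := (exists_rep l)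
  have hx := spinGroup.conjAct_smul_ι_mem_range_ι (Q := negForm m)
    (x := spinGroup.toUnits p.1) p.1.2 v
  obtain ⟨w, hw⟩ := hx
  refine ⟨w, ?_⟩
  rw [ConjAct.units_smul_def, ConjAct.ofConjAct_toConjAct] at hw
  have hinv : spinVal (spinMk p.1 p.2)⁻¹ =
      ((p.2⁻¹ : Circle) : ℂ) ⊗ₜ[ℝ] ((p.1⁻¹ : Spin m) : Cl m) := rfl
  have hv : ∀ v, vec m v = (1 : ℂ) ⊗ₜ[ℝ] CliffordAlgebra.ι (negForm m) v := fun _ => rfl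
  rw [hinv, hv, hv, spinVal_mk, Algebra.TensorProduct.tmul_mul_tmul,
    Algebra.TensorProduct.tmul_mul_tmul, hw, mul_one, ← Circle.coe_mul, mul_inv_cancel]
  rfl

theorem negForm_apply (m : ℕ) (v : Euc m) : negForm m v = -‖v‖ ^ 2 := by
  simp [negForm]

theorem vec_mul_self (m : ℕ) (v : Euc m) :
    vec m v * vec m v = algebraMap ℂ (CCl m) ((negForm m v : ℝ) : ℂ) := by
  have hv : vec m v = (1 : ℂ) ⊗ₜ[ℝ] CliffordAlgebra.ι (negForm m) v := rfl
  rw [hv, Algebra.TensorProduct.tmul_mul_tmul, CliffordAlgebra.ι_sq_scalar,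
    Algebra.algebraMap_eq_smul_one, TensorProduct.tmul_smul,
    Algebra.TensorProduct.algebraMap_apply, TensorProduct.smul_tmul']
  simp

theorem negForm_Ad {m : ℕ} (l : SpinC m) (v : Euc m) : negForm m (Ad l v) = negForm m v := by
  have h := vec_mul_self m (Ad l v)
  have h2 : spinVal l * vec m v * spinVal l⁻¹ * (spinVal l * vec m v * spinVal l⁻¹) =
      spinVal l * (vec m v * vec m v) * spinVal l⁻¹ := by
    have := spinVal_inv_mul l
    calc _ = spinVal l * vec m v * (spinVal l⁻¹ * spinVal l) * vec m v * spinVal l⁻¹ := by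
          simp only [mul_assoc]
      _ = _ := by rw [this]; simp only [mul_assoc, mul_one]
  rw [vec_Ad, h2, vec_mul_self, ← Algebra.commutes, mul_assoc, ← spinVal_mul, mul_inv_cancel,
    spinVal_one, mul_one] at h
  exact_mod_cast (algebraMap_inj m h).symm

/-! ### The extended Clifford algebra `Cl_3` in dimension `4n + 2` -/

/-- The quadratic form `(v, t, z) ↦ -|v|² + t² + (-1)^n |z|²` on `ℝ^(4n+2) ⊕ ℝ ⊕ ℂ`. -/
def form3 (n : ℕ) : QuadraticForm ℝ (Euc (4 * n + 2) × ℝ × ℂ) :=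
  (negForm (4 * n + 2)).prod
    ((QuadraticMap.sq (R := ℝ)).prod
      ((-1 : ℝ) ^ n • LinearMap.BilinMap.toQuadraticMap (innerₗ ℂ)))

theorem form3_apply (n : ℕ) (v : Euc (4 * n + 2)) (t : ℝ) (z : ℂ) :
    form3 n (v, t, z) = -‖v‖ ^ 2 + (t ^ 2 + (-1) ^ n * ‖z‖ ^ 2) := by
  simp [form3, negForm_apply, pow_two t]

/-- The extended Clifford algebra: it is generated by `e_1, …, e_(4n+2)` (with `e_j² = -1`),
`ε_1 = (0, 1, 0)` (with `ε_1² = 1`) and `η_1 = (0, 0, 1)`, `η_2 = (0, 0, i)`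
(with `η_k² = (-1)^n`). So it is `Cl_{4n+2,3}` for even `n` and `Cl_{4n+4,1}` for odd `n`. -/
abbrev Cl3 (n : ℕ) : Type := CliffordAlgebra (form3 n)

/-- The representation `Ad ⊗ z²` of `Spin^c_(4n+2)` on `Cl_3` by algebra endomorphisms, given on
generators by `e_j ↦ Ad λ e_j`, `ε_1 ↦ ε_1`, `η ↦ z²(λ) η`. -/
def adZ2 (n : ℕ) (l : SpinC (4 * n + 2)) : Cl3 n →ₐ[ℝ] Cl3 n :=
  CliffordAlgebra.map
    { toLinearMap := (Ad l).prodMap (LinearMap.id.prodMap (LinearMap.mulLeft ℝ (detChar l)))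
      map_app' := by
        rintro ⟨v, t, z⟩
        have h := negForm_Ad l v
        rw [negForm_apply, negForm_apply] at h
        change form3 n (Ad l v, t, detChar l * z) = form3 n (v, t, z)
        rw [form3_apply, form3_apply, h, norm_mul, norm_detChar, one_mul] }

/-! ### Spinors -/

section Spinor

variable {S : Type*} [NormedAddCommGroup S] [InnerProductSpace ℂ S]

/-- `S` is the (irreducible, unitary) spinor module of `Cl_m ⊗ ℂ`. -/
structure IsSpinorRep {m : ℕ} (ρ : CCl m →ₐ[ℂ] (S →L[ℂ] S)) : Prop where
  nontrivial : Nontrivial S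
  irreducible : ∀ W : Submodule ℂ S, (∀ a : CCl m, ∀ s ∈ W, ρ a s ∈ W) → W = ⊥ ∨ W = ⊤
  skew : ∀ (v : Euc m) (s t : S), inner ℂ (ρ (vec m v) s) t = -inner ℂ s (ρ (vec m v) t)

/-- The grading operator `(-1)^deg = i^(m/2) ρ(e_1 ⋯ e_m)` (for even `m`). -/
def grading {m : ℕ} (ρ : CCl m →ₐ[ℂ] (S →L[ℂ] S)) : S →L[ℂ] S :=
  Complex.I ^ (m / 2) •
    ρ (List.ofFn fun j : Fin m => vec m (EuclideanSpace.single j (1 : ℝ))).prod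

/-- A real representation `ρ'` of `Cl_3` on `S` extends the spinor representation `ρ`: it restricts
to `ρ` on `Cl_{4n+2,0}`, `ε_1` acts by the grading operator, and the action map `Cl_3 × S → S`
is `Spin^c`-equivariant. -/
structure IsExtendedAction {n : ℕ} (ρ : CCl (4 * n + 2) →ₐ[ℂ] (S →L[ℂ] S))
    (ρ' : Cl3 n →ₐ[ℝ] (S →L[ℝ] S)) : Prop where
  restrict : ∀ (v : Euc (4 * n + 2)) (s : S),
    ρ' (CliffordAlgebra.ι (form3 n) (v, 0, 0)) s = ρ (vec (4 * n + 2) v) s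
  grading : ∀ s : S, ρ' (CliffordAlgebra.ι (form3 n) (0, 1, 0)) s = grading ρ s
  equivariant : ∀ (l : SpinC (4 * n + 2)) (a : Cl3 n) (s : S),
    ρ' (adZ2 n l a) (ρ (spinVal l) s) = ρ (spinVal l) (ρ' a s)

/-- The action on `S` of the part `ℂ = ⟨η_1, η_2⟩` of `Cl_3`. -/
def etaAction {n : ℕ} (ρ' : Cl3 n →ₐ[ℝ] (S →L[ℝ] S)) : ℂ →ₗ[ℝ] (S →L[ℝ] S) :=
  ρ'.toLinearMap ∘ₗ CliffordAlgebra.ι (form3 n) ∘ₗ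
    LinearMap.inr ℝ (Euc (4 * n + 2)) (ℝ × ℂ) ∘ₗ LinearMap.inr ℝ ℝ ℂ

end Spinor

/-! ### `Spin^c` structures -/

section Manifold

variable {m : ℕ} {X : Type*} [TopologicalSpace X] [ChartedSpace (Euc m) X]

/-- A map from `X` to the (finite dimensional) algebra `Cl_m ⊗ ℂ` is smooth on `U` if all its real
coordinates are. -/
def SmoothOn (h : X → CCl m) (U : Set X) : Prop :=
  ∀ φ : CCl m →ₗ[ℝ] ℝ, ContMDiffOn 𝓘(ℝ, Euc m) 𝓘(ℝ, ℝ) ∞ (fun x => φ (h x)) U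

/-! ### Finite dimensionality and smooth maps (auxiliary facts) -/

theorem finite_exteriorAlgebra (m : ℕ) : Module.Finite ℝ (ExteriorAlgebra ℝ (Euc m)) := by
  have hbot : ∀ k, m < k → (⋀[ℝ]^k (Euc m)) = ⊥ := by
    intro k hk
    have h := exteriorPower.finrank_eq (R := ℝ) (M := Euc m) k
    rw [finrank_euclideanSpace_fin, Nat.choose_eq_zero_of_lt hk] at h
    exact Submodule.finrank_eq_zero.mp h
  have htop := (DirectSum.Decomposition.isInternal
    (fun k : ℕ => ⋀[ℝ]^k (Euc m))).submodule_iSup_eq_top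
  have h2 : (⨆ k : Fin (m + 1), ⋀[ℝ]^(k : ℕ) (Euc m)) = ⊤ := by
    rw [← top_le_iff, ← htop]
    refine iSup_le fun k => ?_
    by_cases hk : m < k
    · rw [hbot k hk]
      exact bot_le
    · exact le_iSup (fun k : Fin (m + 1) => ⋀[ℝ]^(k : ℕ) (Euc m)) ⟨k, by omega⟩
  rw [Module.finite_def, ← h2]
  exact Submodule.fg_iSup _ fun k => Module.Finite.iff_fg.mp inferInstance

instance finite_Cl (m : ℕ) : Module.Finite ℝ (Cl m) := by
  have := finite_exteriorAlgebra m
  exact Module.Finite.equiv (CliffordAlgebra.equivExterior (negForm m)).symm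

theorem SmoothOn.map {h : X → CCl m} {U : Set X} (hh : SmoothOn h U) {F : Type*}
    [NormedAddCommGroup F] [NormedSpace ℝ F] (L : CCl m →ₗ[ℝ] F) :
    ContMDiffOn 𝓘(ℝ, Euc m) 𝓘(ℝ, F) ∞ (fun x => L (h x)) U := by
  let b := Module.finBasis ℝ (CCl m)
  have e : (fun x => L (h x)) = fun x => ∑ k, b.coord k (h x) • L (b k) := by
    funext x
    calc L (h x) = L (∑ k, b.repr (h x) k • b k) := by rw [b.sum_repr]
      _ = _ := by rw [map_sum]; simp only [map_smul, Module.Basis.coord_apply]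
  rw [e]
  exact contMDiffOn_finsetSum fun k _ => (hh (b.coord k)).smul contMDiffOn_const

theorem SmoothOn.map₂ {h : X → CCl m} {U : Set X} (hh : SmoothOn h U) {F : Type*}
    [NormedAddCommGroup F] [NormedSpace ℝ F] (L : CCl m →ₗ[ℝ] CCl m →ₗ[ℝ] F) :
    ContMDiffOn 𝓘(ℝ, Euc m) 𝓘(ℝ, F) ∞ (fun x => L (h x) (h x)) U := by
  let b := Module.finBasis ℝ (CCl m)
  have e : (fun x => L (h x) (h x)) = fun x => ∑ k, b.coord k (h x) • L (b k) (h x) := by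
    funext x
    calc L (h x) (h x) = L (∑ k, b.repr (h x) k • b k) (h x) := by rw [b.sum_repr]
      _ = _ := by
        rw [map_sum, LinearMap.sum_apply]
        simp only [map_smul, LinearMap.smul_apply, Module.Basis.coord_apply]
  rw [e]
  exact contMDiffOn_finsetSum fun k _ => (hh (b.coord k)).smul (hh.map (L (b k)))

variable [IsManifold 𝓘(ℝ, Euc m) ∞ X]

/-- A `Spin^c` structure on a Riemannian manifold `(X, g)`, presented by a trivializing atlas:
an open cover by sets `U_i`, a principal `Spin^c_m`-bundle given by smooth transition functions
`h_ij : U_i ∩ U_j → Spin^c_m` satisfying the cocycle condition, and the equivariant bundle map to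
the orthonormal frame bundle, given by smooth orthonormal frames `e_i` over `U_i` with
`e_j = e_i ∘ Ad(h_ij)`. (In particular, the frames define an orientation of `X`.) -/
structure SpinCStructure (g : Bundle.ContMDiffRiemannianMetric 𝓘(ℝ, Euc m) ∞ (Euc m)
    (fun x : X => TangentSpace 𝓘(ℝ, Euc m) x)) (ι : Type*) where
  baseSet : ι → Set X
  isOpen_baseSet : ∀ i, IsOpen (baseSet i)
  indexAt : X → ι
  mem_baseSet_at : ∀ x, x ∈ baseSet (indexAt x)
  frame : ι → ∀ x : X, Euc m →ₗ[ℝ] TangentSpace 𝓘(ℝ, Euc m) x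
  frame_orthonormal : ∀ i, ∀ x ∈ baseSet i, ∀ v w : Euc m,
    g.inner x (frame i x v) (frame i x w) = inner ℝ v w
  frame_smooth : ∀ i (v : Euc m),
    ContMDiffOn 𝓘(ℝ, Euc m) (𝓘(ℝ, Euc m).prod 𝓘(ℝ, Euc m)) ∞
      (fun x => Bundle.TotalSpace.mk' (Euc m) x (frame i x v)) (baseSet i)
  trans : ι → ι → X → SpinC m
  trans_comp : ∀ i j k, ∀ x ∈ baseSet i ∩ baseSet j ∩ baseSet k,
    trans i j x * trans j k x = trans i k x
  trans_smooth : ∀ i j, SmoothOn (fun x => spinVal (trans i j x)) (baseSet i ∩ baseSet j)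
  frame_trans : ∀ i j, ∀ x ∈ baseSet i ∩ baseSet j, ∀ v : Euc m,
    frame j x v = frame i x (Ad (trans i j x) v)

namespace SpinCStructure

variable {g : Bundle.ContMDiffRiemannianMetric 𝓘(ℝ, Euc m) ∞ (Euc m)
    (fun x : X => TangentSpace 𝓘(ℝ, Euc m) x)} {ι : Type*} (P : SpinCStructure g ι)

theorem trans_self (i : ι) (x : X) (hx : x ∈ P.baseSet i) : P.trans i i x = 1 := by
  have h := P.trans_comp i i i x ⟨⟨hx, hx⟩, hx⟩
  exact mul_eq_left.mp h

theorem contMDiffOn_detChar (i j : ι) :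
    ContMDiffOn 𝓘(ℝ, Euc m) 𝓘(ℝ, ℂ) ∞ (fun x => detChar (P.trans i j x))
      (P.baseSet i ∩ P.baseSet j) := by
  obtain ⟨ψ, hψ⟩ := LinearMap.exists_leftInverse_of_injective (Algebra.linearMap ℂ (CCl m))
    (LinearMap.ker_eq_bot.mpr (algebraMap_inj m))
  have e : (fun x => detChar (P.trans i j x)) = fun x =>
      ((LinearMap.mul ℝ (CCl m)).compl₁₂ LinearMap.id ((conjT m).restrictScalars ℝ)).compr₂
        (ψ.restrictScalars ℝ) (spinVal (P.trans i j x)) (spinVal (P.trans i j x)) := by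
    funext x
    have h1 := algebraMap_detChar (P.trans i j x)
    have h2 := LinearMap.congr_fun hψ (detChar (P.trans i j x))
    change ψ (algebraMap ℂ (CCl m) (detChar (P.trans i j x))) = detChar (P.trans i j x) at h2
    rw [h1] at h2
    exact h2.symm
  rw [e]
  exact (P.trans_smooth i j).map₂ _

/-- The determinant line bundle `L_X = P ×_{z²} ℂ` of a `Spin^c` structure. -/
def detLineCore : VectorBundleCore ℝ X ℂ ι where
  baseSet := P.baseSet
  isOpen_baseSet := P.isOpen_baseSet
  indexAt := P.indexAt
  mem_baseSet_at := P.mem_baseSet_at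
  coordChange i j x := ContinuousLinearMap.mul ℝ ℂ (detChar (P.trans j i x))
  coordChange_self i x hx v := by simp [P.trans_self i x hx, detChar_one]
  continuousOn_coordChange i j := by
    refine (ContinuousLinearMap.mul ℝ ℂ).continuous.comp_continuousOn ?_
    rw [Set.inter_comm]
    exact (P.contMDiffOn_detChar j i).continuousOn
  coordChange_comp i j k x hx v := by
    rw [← P.trans_comp k j i x ⟨⟨hx.2, hx.1.2⟩, hx.1.1⟩, detChar_mul]
    simp [mul_assoc]

variable {S : Type*} [NormedAddCommGroup S] [InnerProductSpace ℂ S]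
  (ρ : CCl m →ₐ[ℂ] (S →L[ℂ] S))

/-- The spinor bundle `S(X) = P ×_Δ S`. -/
def spinorCore : VectorBundleCore ℝ X S ι where
  baseSet := P.baseSet
  isOpen_baseSet := P.isOpen_baseSet
  indexAt := P.indexAt
  mem_baseSet_at := P.mem_baseSet_at
  coordChange i j x := (ρ (spinVal (P.trans j i x))).restrictScalars ℝ
  coordChange_self i x hx v := by simp [P.trans_self i x hx, spinVal_one]
  continuousOn_coordChange i j := by
    rw [Set.inter_comm]
    exact ((P.trans_smooth j i).map ((ContinuousLinearMap.restrictScalarsₗ ℂ S S ℝ ℝ) ∘ₗ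
      (ρ.toLinearMap.restrictScalars ℝ))).continuousOn
  coordChange_comp i j k x hx v := by
    rw [← P.trans_comp k j i x ⟨⟨hx.2, hx.1.2⟩, hx.1.1⟩, spinVal_mul, map_mul]
    rfl

/-- The fibres of the determinant line bundle `L_X`. -/
abbrev DetLine (x : X) : Type := P.detLineCore.Fiber x

/-- The fibres of the spinor bundle `S(X)`. -/
abbrev Spinor (x : X) : Type _ := (P.spinorCore ρ).Fiber x

instance (x : X) : IsTopologicalAddGroup (P.Spinor ρ x) :=
  inferInstanceAs (IsTopologicalAddGroup S)

instance (x : X) : ContinuousSMul ℝ (P.Spinor ρ x) :=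
  inferInstanceAs (ContinuousSMul ℝ S)

/-- The fibres of the bundle `End_ℝ(S(X))`. -/
abbrev EndSpinor (x : X) : Type _ := P.Spinor ρ x →L[ℝ] P.Spinor ρ x

/-- Clifford multiplication `c_X` by a tangent vector `v ∈ T_x X` on `S(X)_x`: the coordinates of
`v` in the orthonormal frame `e_i`, `i = indexAt x`, act through `ρ` on the spinor read in the
trivialization with the same index (by construction, the fibre of `S(X)` at `x` is `S` itself, read
in this trivialization). -/
def cliffordMul (x : X) (v : TangentSpace 𝓘(ℝ, Euc m) x) : S →L[ℂ] S :=
  ρ (vec m (WithLp.toLp 2 fun j : Fin m =>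
    g.inner x v (P.frame (P.indexAt x) x (EuclideanSpace.single j (1 : ℝ)))))

/-- Sections of class `C^k` of the determinant line bundle. -/
abbrev DetSection (k : ℕ∞) : Type _ :=
  ContMDiffSection 𝓘(ℝ, Euc m) ℂ k P.DetLine

/-- Sections of class `C^k` of the bundle `End_ℝ(S(X))`. -/
abbrev EndSection (k : ℕ∞) : Type _ :=
  ContMDiffSection 𝓘(ℝ, Euc m) (S →L[ℝ] S) k (P.EndSpinor ρ)

/-- The set of points at which a section of the determinant line bundle vanishes. -/
def zeroSet (h : ∀ x, P.DetLine x) : Set X := {x | h x = 0}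

/-- The support of a section of `End_ℝ(S(X))`: the set of points at which it is not invertible. -/
def supp (f : ∀ x, P.EndSpinor ρ x) : Set X := {x | ¬ Function.Bijective (f x)}

end SpinCStructure

/-! ### The line bundle `L_H` and the extended Clifford action -/

namespace SpinCStructure

variable {n : ℕ} {X : Type*} [TopologicalSpace X] [ChartedSpace (Euc (4 * n + 2)) X]
  [IsManifold 𝓘(ℝ, Euc (4 * n + 2)) ∞ X]
  {g : Bundle.ContMDiffRiemannianMetric 𝓘(ℝ, Euc (4 * n + 2)) ∞ (Euc (4 * n + 2))
    (fun x : X => TangentSpace 𝓘(ℝ, Euc (4 * n + 2)) x)}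
  {ι : Type*} (P : SpinCStructure g ι)
  {S : Type*} [NormedAddCommGroup S] [InnerProductSpace ℂ S]
  (ρ : CCl (4 * n + 2) →ₐ[ℂ] (S →L[ℂ] S))

/-- A real endomorphism of the fibre `S(X)_x`, as an endomorphism of `S`. -/
def toModel (x : X) (f : P.EndSpinor ρ x) : S →L[ℝ] S := f

/-- The fibre of `L_H` at `x`: the real endomorphisms of `S(X)_x` which are symmetric (for even
`n`) or skew-symmetric (for odd `n`) for the real inner product `Re ⟨·, ·⟩`, are of odd degree, and
anticommute with Clifford multiplication by tangent vectors. -/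
def lineH (x : X) : Submodule ℝ (P.EndSpinor ρ x) where
  carrier := {f |
    (∀ s t : S, (inner ℂ (P.toModel ρ x f s) t).re =
      (-1) ^ n * (inner ℂ s (P.toModel ρ x f t)).re) ∧
    (∀ s : S, P.toModel ρ x f (grading ρ s) = -grading ρ (P.toModel ρ x f s)) ∧
    (∀ (v : TangentSpace 𝓘(ℝ, Euc (4 * n + 2)) x) (s : S),
      P.toModel ρ x f (P.cliffordMul ρ x v s) = -P.cliffordMul ρ x v (P.toModel ρ x f s))}
  zero_mem' := by
    have h : ∀ s, P.toModel ρ x 0 s = 0 := fun _ => rfl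
    simp [h]
  add_mem' := by
    rintro a b ⟨ha1, ha2, ha3⟩ ⟨hb1, hb2, hb3⟩
    have h : ∀ s, P.toModel ρ x (a + b) s = P.toModel ρ x a s + P.toModel ρ x b s :=
      fun _ => rfl
    refine ⟨fun s t => ?_, fun s => ?_, fun v s => ?_⟩
    · rw [h, h, inner_add_left, inner_add_right, Complex.add_re, Complex.add_re, ha1, hb1, mul_add]
    · rw [h, h, map_add, ha2, hb2, neg_add]
    · rw [h, h, map_add, ha3, hb3, neg_add]
  smul_mem' := by
    rintro c a ⟨ha1, ha2, ha3⟩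
    have h : ∀ s, P.toModel ρ x (c • a) s = (c : ℂ) • P.toModel ρ x a s := fun s =>
      (Complex.coe_smul c (P.toModel ρ x a s)).symm
    refine ⟨fun s t => ?_, fun s => ?_, fun v s => ?_⟩
    · rw [h, h, inner_smul_left, inner_smul_right, Complex.conj_ofReal, Complex.re_ofReal_mul,
        Complex.re_ofReal_mul, ha1]
      ring
    · rw [h, h, map_smul, ha2, smul_neg]
    · rw [h, h, map_smul, ha3, smul_neg]

/-- The map `c̃_X : (L_X)_x → End_ℝ(S(X)_x)` given by the extended Clifford action, where
`(L_X)_x = ℂ` is identified with the span of `η_1 = 1` and `η_2 = i` in `Cl_3` (in the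
trivialization with index `indexAt x`). -/
def extendedMul (ρ' : Cl3 n →ₐ[ℝ] (S →L[ℝ] S)) (x : X) (z : P.DetLine x) : P.EndSpinor ρ x :=
  etaAction ρ' z

/-- The section `f` of `End_ℝ(S(X))` is the extended Clifford action `c̃_X ∘ h` of the section `h`
of the determinant line bundle: in every local trivialization of the `Spin^c` structure, `f` acts
on spinors as `h`, regarded as a function with values in `⟨η_1, η_2⟩ ⊂ Cl_3`, does through `ρ'`. -/
def IsExtendedCliffordImage (ρ' : Cl3 n →ₐ[ℝ] (S →L[ℝ] S)) (h : ∀ x, P.DetLine x)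
    (f : ∀ x, P.EndSpinor ρ x) : Prop :=
  ∀ i, ∀ x ∈ P.baseSet i, ∀ s : P.Spinor ρ x,
    ((P.spinorCore ρ).localTriv i ⟨x, f x s⟩).2 =
      etaAction ρ' (P.detLineCore.localTriv i ⟨x, h x⟩).2
        ((P.spinorCore ρ).localTriv i ⟨x, s⟩).2

end SpinCStructure

end Manifold

end SpinCLine

/-! Everything is decided on one fibre. The grading is `±i` times the volume element, and an
operator anticommuting with all vectors commutes with that product of `4n + 2` of them. For such
operators, odd degree therefore means antilinear (`isAntiCliff_of_odd`, `IsAntiCliff.realGrading`).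
The product of two antilinear ones is complex linear and commutes with Clifford multiplication,
hence is a scalar by Schur's lemma. So they form a complex line as soon as one of them, `J`, has a
nonzero scalar square (`IsAntiCliff.exists_smul_eq`).

Such a `J`, with `J² = (-1)^n` and adjoint `(-1)^n J`, is built in `exists_antilinear` as `C e_1 e_3
⋯ e_{4n+1}` (generators numbered from `0`). Here `C` is an antilinear symmetric involution which
commutes with the even-numbered generators and anticommutes with the odd-numbered ones. It arises by
averaging the conjugate projection onto a common fixed vector of the involutions `i e_{2k} e_{2k+1}`
(`IsCliffordSystem.exists_conj`).

Letting `η` act by `z • J` extends `ρ` to `Cl_3`. The extension is equivariant because `J` commutes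
with the even elements of `Spin` and turns a phase `u` into its conjugate, which the factor `u²`
corrects. Conversely, equivariance under the phases `u` makes the action of `η` in any extension
antilinear on spinors and complex linear in `η`; so it always runs through the line spanned by `J`.

Equivariance under the transition functions makes the fibrewise map independent of the
trivialization. In coordinates it is a constant injective linear map, so it preserves and reflects
`C^k` regularity; its values at nonzero vectors are invertible because their squares are nonzero
scalars. -/

namespace SpinCLine

/-! ### Products of anticommuting elements -/

section Ring

variable {R : Type*} [Ring R]

/-- The product `A e_0 e_1 ⋯ e_{k-1}`. -/
def mulSeq (A : R) (e : ℕ → R) : ℕ → R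
  | 0 => A
  | k + 1 => mulSeq A e k * e k

/-- Each factor passed costs one sign; `t` records the sign for passing `A`. -/
theorem mulSeq_mul_of_anticomm {A : R} {e : ℕ → R} {x : R} {t k : ℕ}
    (hA : A * x = (-1 : ℤ) ^ t • (x * A)) (he : ∀ i < k, e i * x = -(x * e i)) :
    mulSeq A e k * x = (-1 : ℤ) ^ (t + k) • (x * mulSeq A e k) := by
  induction k with
  | zero => simpa [mulSeq] using hA
  | succ k ih =>
    have h := ih fun i hi => he i (by omega)
    rw [mulSeq, mul_assoc, he k (by omega), mul_neg, ← mul_assoc, h, smul_mul_assoc, mul_assoc,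
      ← add_assoc, pow_succ, mul_smul, neg_one_smul, smul_neg]

/-- The factor `e j` commutes with itself, so one sign is lost: `t + k - 1`, written `t + k + 1` to
avoid truncated subtraction. -/
theorem mulSeq_mul_self_of_lt {A : R} {e : ℕ → R} {t j k : ℕ}
    (hA : A * e j = (-1 : ℤ) ^ t • (e j * A)) (he : ∀ i, i ≠ j → e i * e j = -(e j * e i))
    (hj : j < k) :
    mulSeq A e k * e j = (-1 : ℤ) ^ (t + k + 1) • (e j * mulSeq A e k) := by
  induction k, (Nat.succ_le_of_lt hj) using Nat.le_induction with
  | base =>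
    have h := mulSeq_mul_of_anticomm (k := j) hA fun i hi => he i (by omega)
    have h2 : (-1 : ℤ) ^ (t + j.succ + 1) = (-1) ^ (t + j) := by
      rw [show t + j.succ + 1 = t + j + 2 by omega, pow_add, neg_one_sq, mul_one]
    rw [mulSeq, h2, h, smul_mul_assoc, mul_assoc, h]
  | succ k hk ih =>
    rw [mulSeq, mul_assoc, he k (by omega), mul_neg, ← mul_assoc, ih (by omega), smul_mul_assoc,
      mul_assoc, show t + (k + 1) + 1 = t + k + 1 + 1 by omega, pow_succ _ (t + k + 1), mul_smul,
      neg_one_smul, smul_neg]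

/-- Appending the factor `e k` contributes `t + k` signs for moving it across the product and one
more from `e k ^ 2 = -1`. -/
theorem mulSeq_sq {A : R} {e : ℕ → R} {t k : ℕ}
    (hA : ∀ j < k, A * e j = (-1 : ℤ) ^ t • (e j * A))
    (he : ∀ i j, i ≠ j → e i * e j = -(e j * e i)) (hsq : ∀ j < k, e j * e j = -1) :
    mulSeq A e k * mulSeq A e k =
      (-1 : ℤ) ^ (k * (t + 1) + ∑ i ∈ Finset.range k, i) • (A * A) := by
  induction k with
  | zero => simp [mulSeq]
  | succ k ih =>
    have h := mulSeq_mul_of_anticomm (k := k) (hA k (by omega)) fun i hi => he i k (by omega)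
    have h2 : e k * mulSeq A e k = (-1 : ℤ) ^ (t + k) • (mulSeq A e k * e k) := by
      rw [h, smul_smul, ← mul_pow]
      simp
    have ih := ih (fun j hj => hA j (by omega)) (fun j hj => hsq j (by omega))
    have h3 : mulSeq A e (k + 1) * mulSeq A e (k + 1) =
        mulSeq A e k * (e k * mulSeq A e k) * e k := by
      simp only [mulSeq, mul_assoc]
    rw [h3, h2, mul_smul_comm, smul_mul_assoc, ← mul_assoc, mul_assoc, hsq k (by omega), mul_neg,
      mul_one, ih, ← neg_one_smul ℤ ((-1 : ℤ) ^ _ • (A * A)), smul_smul, smul_smul,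
      Finset.sum_range_succ]
    congr 1
    ring

end Ring

/-! ### Real endomorphisms of a complex inner product space -/

section Spinor

variable {S : Type*} [NormedAddCommGroup S] [InnerProductSpace ℂ S]

/-- Multiplication by `i`, as a real endomorphism. -/
def mulI (S : Type*) [NormedAddCommGroup S] [InnerProductSpace ℂ S] : S →L[ℝ] S :=
  (Complex.I • ContinuousLinearMap.id ℂ S).restrictScalars ℝ

@[simp] theorem mulI_apply (s : S) : mulI S s = Complex.I • s := rfl

theorem mulI_mul_mulI : mulI S * mulI S = -1 := by
  ext s
  simp [smul_smul]

theorem complex_smul_eq (z : ℂ) (s : S) : z • s = z.re • s + z.im • (Complex.I • s) := by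
  conv_lhs => rw [← Complex.re_add_im z]
  rw [add_smul, mul_smul, Complex.coe_smul, Complex.coe_smul]

theorem map_smul_of_commute {f : S →L[ℝ] S} (h : f * mulI S = mulI S * f) (z : ℂ) (s : S) :
    f (z • s) = z • f s := by
  have h1 : f (Complex.I • s) = Complex.I • f s := congrArg (fun g : S →L[ℝ] S => g s) h
  rw [complex_smul_eq, map_add, map_smul, map_smul, h1, ← complex_smul_eq]

theorem map_smul_of_anticommute {f : S →L[ℝ] S} (h : f * mulI S = -(mulI S * f)) (z : ℂ) (s : S) :
    f (z • s) = (starRingEnd ℂ z) • f s := by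
  have h1 : f (Complex.I • s) = -(Complex.I • f s) := congrArg (fun g : S →L[ℝ] S => g s) h
  rw [complex_smul_eq, map_add, map_smul, map_smul, h1, complex_smul_eq (starRingEnd ℂ z)]
  simp

/-- `B` is the adjoint of `A` for the real inner product `Re ⟨·, ·⟩`. -/
def IsRealAdjoint (A B : S →L[ℝ] S) : Prop :=
  ∀ s t : S, (inner ℂ (A s) t).re = (inner ℂ s (B t)).re

theorem IsRealAdjoint.mul {A A' B B' : S →L[ℝ] S} (h : IsRealAdjoint A A')
    (h' : IsRealAdjoint B B') : IsRealAdjoint (A * B) (B' * A') := fun s t => by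
  simp only [mul_apply_eq_comp]
  rw [h, h']

theorem IsRealAdjoint.sub {A A' B B' : S →L[ℝ] S} (h : IsRealAdjoint A A')
    (h' : IsRealAdjoint B B') : IsRealAdjoint (A - B) (A' - B') := fun s t => by
  simp only [sub_apply, inner_sub_left, inner_sub_right, Complex.sub_re]
  rw [h, h']

/-- Taking adjoints reverses the product, and restoring the order costs the same signs as squaring;
skewness of `e k` replaces `e k ^ 2 = -1`. -/
theorem mulSeq_isRealAdjoint {A : S →L[ℝ] S} {e : ℕ → S →L[ℝ] S} {t k : ℕ}
    (hadj : IsRealAdjoint A A) (hA : ∀ j < k, A * e j = (-1 : ℤ) ^ t • (e j * A))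
    (he : ∀ i j, i ≠ j → e i * e j = -(e j * e i)) (hskew : ∀ j, IsRealAdjoint (e j) (-e j)) :
    IsRealAdjoint (mulSeq A e k)
      ((-1 : ℤ) ^ (k * (t + 1) + ∑ i ∈ Finset.range k, i) • mulSeq A e k) := by
  induction k with
  | zero => simpa [mulSeq] using hadj
  | succ k ih =>
    have h := mulSeq_mul_of_anticomm (k := k) (hA k (by omega)) fun i hi => he i k (by omega)
    have h2 : e k * mulSeq A e k = (-1 : ℤ) ^ (t + k) • (mulSeq A e k * e k) := by
      rw [h, smul_smul, ← mul_pow]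
      simp
    have := (ih fun j hj => hA j (by omega)).mul (hskew k)
    rw [neg_mul, mul_smul_comm, h2, smul_smul, ← neg_one_smul ℤ, smul_smul] at this
    have h4 : (-1 : ℤ) ^ ((k + 1) * (t + 1) + ∑ i ∈ Finset.range (k + 1), i) =
        -1 * ((-1) ^ (k * (t + 1) + ∑ i ∈ Finset.range k, i) * (-1) ^ (t + k)) := by
      rw [Finset.sum_range_succ]
      ring
    rw [h4]
    exact this

/-! ### A conjugation commuting with half of the generators -/

/-- The involution `i e_{2k} e_{2k+1}`. -/
def pairInv (e : ℕ → S →L[ℝ] S) (k : ℕ) : S →L[ℝ] S := mulI S * (e (2 * k) * e (2 * k + 1))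

/-- Complex linear, anticommuting real endomorphisms `e_0, …, e_{2N-1}` of square `-1`. -/
structure IsCliffordSystem (N : ℕ) (e : ℕ → S →L[ℝ] S) : Prop where
  comm : ∀ j, e j * mulI S = mulI S * e j
  anti : ∀ i j, i ≠ j → e i * e j = -(e j * e i)
  sq : ∀ j < 2 * N, e j * e j = -1
  skew : ∀ j, IsRealAdjoint (e j) (-e j)

namespace IsCliffordSystem

variable {N : ℕ} {e : ℕ → S →L[ℝ] S} (he : IsCliffordSystem N e)
include he

theorem pairInv_mul_gen {j k : ℕ} (h1 : j ≠ 2 * k) (h2 : j ≠ 2 * k + 1) :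
    pairInv e k * e j = e j * pairInv e k := by
  rw [pairInv, mul_assoc, mul_assoc, he.anti _ j h2.symm, mul_neg, ← mul_assoc (e (2 * k)),
    he.anti _ j h1.symm, neg_mul, neg_neg, ← mul_assoc, ← mul_assoc, ← he.comm]
  simp only [mul_assoc]

theorem pairInv_mul_mulI (k : ℕ) : pairInv e k * mulI S = mulI S * pairInv e k := by
  rw [pairInv, mul_assoc, mul_assoc, he.comm, ← mul_assoc (e (2 * k)), he.comm, mul_assoc]

/-- Hence `e_{2k}` exchanges the two eigenspaces of its own involution, while it commutes with all
the others. -/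
theorem pairInv_mul_even (k : ℕ) : pairInv e k * e (2 * k) = -(e (2 * k) * pairInv e k) := by
  rw [pairInv, mul_assoc, mul_assoc, he.anti (2 * k + 1) (2 * k) (by omega), ← mul_assoc (e _),
    he.comm]
  simp only [mul_assoc, mul_neg]

theorem pairInv_sq {k : ℕ} (hk : k < N) : pairInv e k * pairInv e k = 1 := by
  have h : pairInv e k * pairInv e k =
      mulI S * (pairInv e k * e (2 * k)) * e (2 * k + 1) := by
    conv_lhs => rw [← mul_one (pairInv e k * pairInv e k)]
    rw [mul_one]
    conv_lhs => arg 2; rw [pairInv]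
    rw [← mul_assoc, he.pairInv_mul_mulI]
    simp only [mul_assoc]
  rw [h, he.pairInv_mul_even, pairInv]
  have h3 : mulI S * -(e (2 * k) * (mulI S * (e (2 * k) * e (2 * k + 1)))) * e (2 * k + 1) =
      -((mulI S * (e (2 * k) * mulI S)) * e (2 * k) * (e (2 * k + 1) * e (2 * k + 1))) := by
    noncomm_ring
  rw [h3, he.comm, ← mul_assoc (mulI S), mulI_mul_mulI, he.sq (2 * k + 1) (by omega),
    mul_assoc (-1), he.sq (2 * k) (by omega)]
  noncomm_ring

theorem pairInv_comm (j k : ℕ) : pairInv e j * pairInv e k = pairInv e k * pairInv e j := by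
  rcases eq_or_ne j k with rfl | h
  · rfl
  · conv_lhs => rw [pairInv.eq_1 e k]
    conv_rhs => rw [pairInv.eq_1 e k]
    rw [← mul_assoc, he.pairInv_mul_mulI, mul_assoc, ← mul_assoc (pairInv e j),
      he.pairInv_mul_gen (by omega) (by omega), mul_assoc, he.pairInv_mul_gen (by omega) (by omega)]
    simp only [mul_assoc]

/-- The involutions are made to fix a vector one at a time. The fixed vector is finally normalized
so that the rank one operator built from it fixes it. -/
theorem exists_vacuum [Nontrivial S] :
    ∃ s : S, ‖s‖ = 1 ∧ ∀ j < N, pairInv e j s = s := by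
  suffices h : ∀ k ≤ N, ∃ s : S, s ≠ 0 ∧ ∀ j < k, pairInv e j s = s by
    obtain ⟨s, hs, h⟩ := h N le_rfl
    refine ⟨((‖s‖ : ℝ)⁻¹) • s, ?_, fun j hj => by rw [map_smul, h j hj]⟩
    rw [norm_smul, norm_inv, norm_norm, inv_mul_cancel₀ (norm_ne_zero_iff.mpr hs)]
  intro k
  induction k with
  | zero =>
    obtain ⟨s, hs⟩ := exists_ne (0 : S)
    exact fun _ => ⟨s, hs, by simp⟩
  | succ k ih =>
    intro hk
    obtain ⟨s, hs, h⟩ := ih (by omega)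
    have hT : ∀ s, pairInv e k (pairInv e k s) = s := fun s =>
      congrArg (fun g : S →L[ℝ] S => g s) (he.pairInv_sq (k := k) (by omega))
    -- Either the symmetrization `s + T_k s` is nonzero and fixed by `T_k`, or `T_k s = -s` and
    -- `e_{2k}` moves `s` into the fixed space of `T_k`.
    by_cases h0 : s + pairInv e k s = 0
    · have h1 : pairInv e k s = -s := eq_neg_of_add_eq_zero_right h0
      refine ⟨e (2 * k) s, fun h2 => hs ?_, fun j hj => ?_⟩
      · have h3 : e (2 * k) (e (2 * k) s) = -s :=
          congrArg (fun g : S →L[ℝ] S => g s) (he.sq (2 * k) (by omega))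
        rw [h2, map_zero] at h3
        exact neg_eq_zero.mp h3.symm
      · rcases Nat.lt_succ_iff_lt_or_eq.mp hj with hj | rfl
        · have h3 : pairInv e j (e (2 * k) s) = e (2 * k) (pairInv e j s) :=
            congrArg (fun g : S →L[ℝ] S => g s)
              (he.pairInv_mul_gen (j := 2 * k) (k := j) (by omega) (by omega))
          rw [h3, h j hj]
        · have h3 : pairInv e j (e (2 * j) s) = -(e (2 * j) (pairInv e j s)) :=
            congrArg (fun g : S →L[ℝ] S => g s) (he.pairInv_mul_even j)
          rw [h3, h1, map_neg, neg_neg]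
    · refine ⟨s + pairInv e k s, h0, fun j hj => ?_⟩
      rcases Nat.lt_succ_iff_lt_or_eq.mp hj with hj | rfl
      · have h3 : pairInv e j (pairInv e k s) = pairInv e k (pairInv e j s) :=
          congrArg (fun g : S →L[ℝ] S => g s) (he.pairInv_comm j k)
        rw [map_add, h3, h j hj]
      · rw [map_add, hT, add_comm]

end IsCliffordSystem

/-- Starting from `C`, the successive averages `C ↦ C - e_{2k} C e_{2k}`. -/
def averageSeq (C : S →L[ℝ] S) (e : ℕ → S →L[ℝ] S) : ℕ → S →L[ℝ] S
  | 0 => C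
  | k + 1 => averageSeq C e k - e (2 * k) * averageSeq C e k * e (2 * k)

namespace IsCliffordSystem

variable {N : ℕ} {e : ℕ → S →L[ℝ] S} (he : IsCliffordSystem N e)
include he

theorem averageSeq_mulI {C : S →L[ℝ] S} (hC : C * mulI S = -(mulI S * C)) (k : ℕ) :
    averageSeq C e k * mulI S = -(mulI S * averageSeq C e k) := by
  induction k with
  | zero => exact hC
  | succ k ih =>
    rw [averageSeq, sub_mul, ih, mul_assoc, he.comm, ← mul_assoc, mul_assoc (e _), ih, mul_neg,
      ← mul_assoc, he.comm]
    noncomm_ring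

theorem averageSeq_isRealAdjoint {C : S →L[ℝ] S} (hC : IsRealAdjoint C C) (k : ℕ) :
    IsRealAdjoint (averageSeq C e k) (averageSeq C e k) := by
  induction k with
  | zero => exact hC
  | succ k ih =>
    have h := ih.sub (((he.skew (2 * k)).mul ih).mul (he.skew (2 * k)))
    rw [neg_mul, mul_neg, mul_neg, neg_neg, ← mul_assoc] at h
    exact h

/-- Steps before `j` involve only generators commuting with the `j`-th involution, so the absorption
property survives until it is needed at step `j`. -/
theorem averageSeq_fix {C : S →L[ℝ] S}
    (hC : ∀ j < N, C * pairInv e j = C ∧ pairInv e j * C = C) (k : ℕ) :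
    ∀ j, k ≤ j → j < N → averageSeq C e k * pairInv e j = averageSeq C e k ∧
      pairInv e j * averageSeq C e k = averageSeq C e k := by
  induction k with
  | zero => exact fun j _ hj => hC j hj
  | succ k ih =>
    intro j hkj hj
    obtain ⟨h1, h2⟩ := ih j (by omega) hj
    have h3 := he.pairInv_mul_gen (j := 2 * k) (k := j) (by omega) (by omega)
    rw [averageSeq, sub_mul, mul_sub, h1, h2, mul_assoc, ← h3, ← mul_assoc, mul_assoc (e _), h1,
      ← mul_assoc, ← mul_assoc, h3, mul_assoc (e _) (pairInv e j), h2]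
    exact ⟨rfl, rfl⟩

/-- Since `e² = -1`, multiplying `A - eAe` by `e` on either side gives `Ae + eA`. Later steps keep
the relation, because the two signs from exchanging distinct generators cancel. -/
theorem averageSeq_comm {C : S →L[ℝ] S}
    (hC : ∀ j < N, C * pairInv e j = C ∧ pairInv e j * C = C) {k : ℕ} (hk : k ≤ N) :
    ∀ j < k, averageSeq C e k * e (2 * j) = e (2 * j) * averageSeq C e k ∧
      averageSeq C e k * pairInv e j = pairInv e j * averageSeq C e k := by
  induction k with
  | zero => simp
  | succ k ih =>
    intro j hj
    rw [averageSeq]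
    set A := averageSeq C e k with hA
    rcases Nat.lt_succ_iff_lt_or_eq.mp hj with hj | rfl
    · obtain ⟨h1, h2⟩ := ih (by omega) j hj
      have h3 := he.pairInv_mul_gen (j := 2 * k) (k := j) (by omega) (by omega)
      have h4 := he.anti (2 * k) (2 * j) (by omega)
      constructor
      · rw [sub_mul, mul_sub, h1, mul_assoc, h4, mul_neg, ← mul_assoc, mul_assoc (e _), h1,
          ← mul_assoc, h4]
        noncomm_ring
      · rw [sub_mul, mul_sub, h2, mul_assoc, ← h3, ← mul_assoc, mul_assoc (e _), h2,
          ← mul_assoc (e _), ← h3]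
        noncomm_ring
    · obtain ⟨h1, h2⟩ := he.averageSeq_fix hC j j le_rfl (by omega)
      have h3 := he.pairInv_mul_even j
      have h4 := he.sq (2 * j) (by omega)
      have h5 : e (2 * j) * pairInv e j = -(pairInv e j * e (2 * j)) := by rw [h3, neg_neg]
      constructor
      · rw [sub_mul, mul_sub, mul_assoc _ _ (e _), h4, ← mul_assoc, ← mul_assoc, h4]
        noncomm_ring
      · rw [sub_mul, mul_sub, h1, h2, mul_assoc _ _ (pairInv e j), h5, mul_neg, ← mul_assoc,
          mul_assoc (e _), h1, ← mul_assoc, ← mul_assoc, h3, neg_mul, neg_mul,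
          mul_assoc (e _) (pairInv e j), hA, h2, mul_assoc]

/-- The vector `e_{2k} s` lies in the `-1` eigenspace of the `k`-th involution, which the operator
absorbs on the right. The operator thus kills `e_{2k} s`, and the correction term vanishes at `s`.
-/
theorem averageSeq_vacuum {C : S →L[ℝ] S}
    (hC : ∀ j < N, C * pairInv e j = C ∧ pairInv e j * C = C) {s : S}
    (hs : ∀ j < N, pairInv e j s = s) (hCs : C s = s) {k : ℕ} (hk : k ≤ N) :
    averageSeq C e k s = s := by
  induction k with
  | zero => exact hCs
  | succ k ih =>
    obtain ⟨h1, -⟩ := he.averageSeq_fix hC k k le_rfl (by omega)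
    have h3 : pairInv e k (e (2 * k) s) = -(e (2 * k) (pairInv e k s)) :=
      congrArg (fun g : S →L[ℝ] S => g s) (he.pairInv_mul_even k)
    have h4 : averageSeq C e k (pairInv e k (e (2 * k) s)) = averageSeq C e k (e (2 * k) s) :=
      congrArg (fun g : S →L[ℝ] S => g (e (2 * k) s)) h1
    rw [h3, hs k (by omega), map_neg] at h4
    have h5 : averageSeq C e k (e (2 * k) s) = 0 := by
      refine (smul_eq_zero_iff_right (two_ne_zero (α := ℝ))).mp ?_
      rw [two_smul]
      nth_rewrite 1 [← h4]
      exact neg_add_cancel _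
    rw [averageSeq, sub_apply, ih (by omega), mul_apply_eq_comp,
      mul_apply_eq_comp, h5, map_zero, sub_zero]

end IsCliffordSystem

end Spinor
end SpinCLine

/-! ### The antilinear conjugation obtained from a vacuum vector -/

namespace SpinCLine

section Spinor

variable {S : Type*} [NormedAddCommGroup S] [InnerProductSpace ℂ S]

theorem mulI_isRealAdjoint : IsRealAdjoint (mulI S) (-mulI S) := fun s t => by
  simp [inner_smul_right]

theorem IsCliffordSystem.pairInv_isRealAdjoint {N : ℕ} {e : ℕ → S →L[ℝ] S}
    (he : IsCliffordSystem N e) (k : ℕ) : IsRealAdjoint (pairInv e k) (pairInv e k) := by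
  have h := mulI_isRealAdjoint.mul ((he.skew (2 * k)).mul (he.skew (2 * k + 1)))
  rw [neg_mul_neg, he.anti (2 * k + 1) (2 * k) (by omega), neg_mul_neg, mul_assoc (e _), he.comm,
    ← mul_assoc (e _), he.comm, mul_assoc (mulI S)] at h
  exact h

/-- The imaginary part of the identity is its real part at `i s`. -/
theorem IsRealAdjoint.inner_eq {A B : S →L[ℝ] S} (h : IsRealAdjoint A B)
    (hA : A * mulI S = mulI S * A) (s t : S) : inner ℂ (A s) t = inner ℂ s (B t) := by
  refine Complex.ext (h s t) ?_
  have h1 := h (Complex.I • s) t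
  rw [map_smul_of_commute hA, inner_smul_left, inner_smul_left] at h1
  simpa using h1

/-- The antilinear map `s ↦ ⟨s, s₀⟩ s₀`. -/
def conjProj [FiniteDimensional ℂ S] (s₀ : S) : S →L[ℝ] S :=
  have : FiniteDimensional ℝ S := FiniteDimensional.complexToReal S
  LinearMap.toContinuousLinearMap
    { toFun s := inner ℂ s s₀ • s₀
      map_add' s t := by rw [inner_add_left, add_smul]
      map_smul' c s := by
        rw [← Complex.coe_smul c s, inner_smul_left, Complex.conj_ofReal, mul_smul,
          Complex.coe_smul]
        rfl }

@[simp] theorem conjProj_apply [FiniteDimensional ℂ S] (s₀ s : S) :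
    conjProj s₀ s = (inner ℂ s s₀ : ℂ) • s₀ := rfl

theorem conjProj_mulI [FiniteDimensional ℂ S] (s₀ : S) :
    conjProj s₀ * mulI S = -(mulI S * conjProj s₀) := by
  ext s
  simp [smul_smul, mul_comm]

theorem conjProj_isRealAdjoint [FiniteDimensional ℂ S] (s₀ : S) :
    IsRealAdjoint (conjProj s₀) (conjProj s₀) := fun s t => by
  rw [conjProj_apply, conjProj_apply, inner_smul_left, inner_smul_right,
    ← inner_conj_symm t s₀]
  simp only [Complex.mul_re, Complex.conj_re, Complex.conj_im]
  ring

/-- There is an antilinear symmetric operator `C` commuting with `e_{2k}`, anticommuting with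
`e_{2k+1}` and with a nonzero fixed vector. -/
theorem IsCliffordSystem.exists_conj [FiniteDimensional ℂ S] [Nontrivial S] {N : ℕ}
    {e : ℕ → S →L[ℝ] S} (he : IsCliffordSystem N e) :
    ∃ C : S →L[ℝ] S, C * mulI S = -(mulI S * C) ∧ IsRealAdjoint C C ∧
      (∀ k < N, C * e (2 * k) = e (2 * k) * C) ∧
      (∀ k < N, C * e (2 * k + 1) = -(e (2 * k + 1) * C)) ∧ ∃ s : S, s ≠ 0 ∧ C s = s := by
  obtain ⟨s, hs, hT⟩ := he.exists_vacuum
  -- The involutions are symmetric, complex linear and fix `s`, so the rank one operator absorbs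
  -- them on both sides.
  have hC : ∀ j < N, conjProj s * pairInv e j = conjProj s ∧
      pairInv e j * conjProj s = conjProj s := fun j hj => by
    constructor
    · ext t
      rw [mul_apply_eq_comp, conjProj_apply, conjProj_apply,
        (he.pairInv_isRealAdjoint j).inner_eq (he.pairInv_mul_mulI j), hT j hj]
    · ext t
      rw [mul_apply_eq_comp, conjProj_apply, map_smul_of_commute (he.pairInv_mul_mulI j), hT j hj]
  have hCs : conjProj s s = s := by
    rw [conjProj_apply, inner_self_eq_norm_sq_to_K, hs]
    simp
  have hI := he.averageSeq_mulI (conjProj_mulI s) N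
  have hcomm := he.averageSeq_comm hC le_rfl
  refine ⟨averageSeq (conjProj s) e N, hI, he.averageSeq_isRealAdjoint (conjProj_isRealAdjoint s) N,
    fun k hk => (hcomm k hk).1, fun k hk => ?_, s, ?_, he.averageSeq_vacuum hC hT hCs le_rfl⟩
  · obtain ⟨h1, h2⟩ := hcomm k hk
    -- `C` commutes with both `e_{2k}` and the involution, so the sign for `e_{2k+1}` comes only
    -- from the factor `i` and antilinearity.
    have h3 : e (2 * k + 1) = mulI S * (e (2 * k) * pairInv e k) := by
      rw [pairInv, ← mul_assoc (e _), he.comm, mul_assoc (mulI S), ← mul_assoc (e _),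
        he.sq _ (by omega), ← mul_assoc, mulI_mul_mulI]
      noncomm_ring
    rw [h3, ← mul_assoc, hI, neg_mul, mul_assoc, ← mul_assoc _ (e _), h1, mul_assoc (e _), h2]
    simp only [mul_assoc]
  · rintro rfl
    simp at hs

/-- The sign in `mulSeq_sq` for `2n + 1` factors and `t = 1`: the first summand is even and the
second is `(2n + 1) n`. -/
theorem neg_one_pow_sum_range (n : ℕ) :
    (-1 : ℤ) ^ ((2 * n + 1) * (1 + 1) + ∑ i ∈ Finset.range (2 * n + 1), i) = (-1) ^ n := by
  have h := Finset.sum_range_id_mul_two (2 * n + 1)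
  have h2 : ∑ i ∈ Finset.range (2 * n + 1), i = (2 * n + 1) * n := by
    rw [Nat.add_sub_cancel] at h
    nlinarith
  rw [h2, pow_add, pow_mul', pow_mul]
  simp [Odd.neg_one_pow (odd_two_mul_add_one n)]

/-! ### The spinor representation -/

section Rep

variable {m : ℕ} (ρ : CCl m →ₐ[ℂ] (S →L[ℂ] S))

/-- The spinor representation by real endomorphisms. -/
def realRep : CCl m →ₐ[ℝ] (S →L[ℝ] S) :=
  AlgHom.ofLinearMap ((ContinuousLinearMap.restrictScalarsₗ ℂ S S ℝ ℝ) ∘ₗ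
      (ρ.toLinearMap.restrictScalars ℝ)) (by ext s; simp) (fun a b => by ext s; simp)

@[simp] theorem realRep_apply (a : CCl m) (s : S) : realRep ρ a s = ρ a s := rfl

/-- Clifford multiplication by vectors. -/
def cliff : Euc m →ₗ[ℝ] (S →L[ℝ] S) := (realRep ρ).toLinearMap ∘ₗ vec m

@[simp] theorem cliff_apply (v : Euc m) (s : S) : cliff ρ v s = ρ (vec m v) s := rfl

theorem realRep_mul_mulI (a : CCl m) : realRep ρ a * mulI S = mulI S * realRep ρ a := by
  ext s
  simp

theorem cliff_mul_self (v : Euc m) : cliff ρ v * cliff ρ v = (-‖v‖ ^ 2 : ℝ) • 1 := by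
  change realRep ρ (vec m v) * realRep ρ (vec m v) = _
  rw [← map_mul, vec_mul_self, negForm_apply]
  ext s
  simp only [Algebra.algebraMap_eq_smul_one, map_smul, map_one, realRep_apply, smul_apply,
    one_apply_eq_self]
  rw [Complex.coe_smul]

theorem cliff_anticomm {v w : Euc m} (h : inner ℝ v w = 0) :
    cliff ρ v * cliff ρ w = -(cliff ρ w * cliff ρ v) := by
  have h1 := cliff_mul_self ρ (v + w)
  rw [map_add, add_mul, mul_add, mul_add, cliff_mul_self, cliff_mul_self,
    norm_add_sq_real, h] at h1
  have h2 : cliff ρ v * cliff ρ w + cliff ρ w * cliff ρ v =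
      ((-‖v‖ ^ 2 : ℝ) • 1 + cliff ρ v * cliff ρ w +
        (cliff ρ w * cliff ρ v + (-‖w‖ ^ 2 : ℝ) • 1)) - (-(‖v‖ ^ 2 + 2 * 0 + ‖w‖ ^ 2) : ℝ) •
          (1 : S →L[ℝ] S) := by
    module
  rw [h1, sub_self] at h2
  exact eq_neg_of_add_eq_zero_left h2

/-- The standard generators `e_0, …, e_{m-1}`, continued by zero. -/
def stdVec (m : ℕ) (j : ℕ) : Euc m :=
  if h : j < m then EuclideanSpace.single ⟨j, h⟩ 1 else 0

theorem inner_stdVec {i j : ℕ} (h : i ≠ j) : inner ℝ (stdVec m i) (stdVec m j) = 0 := by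
  unfold stdVec
  split_ifs
  · rw [EuclideanSpace.inner_single_left, map_one, one_mul, PiLp.single_apply, if_neg]
    simpa [Fin.ext_iff] using h
  · exact inner_zero_right _
  · exact inner_zero_left _
  · exact inner_zero_left _

theorem norm_stdVec {j : ℕ} (h : j < m) : ‖stdVec m j‖ = 1 := by
  simp [stdVec, h]

theorem isRealAdjoint_cliff {ρ : CCl m →ₐ[ℂ] (S →L[ℂ] S)} (hρ : IsSpinorRep ρ) (v : Euc m) :
    IsRealAdjoint (cliff ρ v) (-cliff ρ v) := fun s t => by
  have h := hρ.skew v s t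
  rw [cliff_apply, h]
  simp

theorem isCliffordSystem {ρ : CCl m →ₐ[ℂ] (S →L[ℂ] S)} (hρ : IsSpinorRep ρ) {N : ℕ} (hN : 2 * N ≤ m) :
    IsCliffordSystem N fun j => cliff ρ (stdVec m j) where
  comm j := realRep_mul_mulI ρ _
  anti i j h := cliff_anticomm ρ (inner_stdVec h)
  sq j h := by simp [cliff_mul_self, norm_stdVec (h.trans_le hN)]
  skew j := isRealAdjoint_cliff hρ _

theorem eq_of_stdVec {F : Type*} [AddCommGroup F] [Module ℝ F] {f g : Euc m →ₗ[ℝ] F}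
    (h : ∀ j < m, f (stdVec m j) = g (stdVec m j)) : f = g := by
  refine (EuclideanSpace.basisFun (Fin m) ℝ).toBasis.ext fun j => ?_
  have := h j j.2
  simpa [stdVec] using this

/-- The commutation with vectors passes to the Clifford algebra. -/
theorem commute_realRep {f : S →L[ℝ] S} (hf : ∀ v, f * cliff ρ v = cliff ρ v * f) (x : Cl m) :
    f * realRep ρ (1 ⊗ₜ x) = realRep ρ (1 ⊗ₜ x) * f := by
  induction x using CliffordAlgebra.induction with
  | algebraMap r =>
    have : (1 : ℂ) ⊗ₜ[ℝ] algebraMap ℝ (Cl m) r = algebraMap ℝ (CCl m) r :=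
      (Algebra.TensorProduct.includeRight : Cl m →ₐ[ℝ] CCl m).commutes r
    rw [this, AlgHom.commutes, Algebra.commutes]
  | ι v => exact hf v
  | mul a b ha hb =>
    have : (1 : ℂ) ⊗ₜ[ℝ] (a * b) = (1 ⊗ₜ a) * (1 ⊗ₜ b) := by
      rw [Algebra.TensorProduct.tmul_mul_tmul, one_mul]
    rw [this, map_mul, ← mul_assoc, ha, mul_assoc, hb, mul_assoc]
  | add a b ha hb => rw [TensorProduct.tmul_add, map_add, mul_add, add_mul, ha, hb]

/-- Elements of `Spin` are fixed by `involute`, so an operator anticommuting with vectors commutes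
with `Spin`. -/
theorem anticommute_realRep {f : S →L[ℝ] S} (hf : ∀ v, f * cliff ρ v = -(cliff ρ v * f))
    (x : Cl m) :
    f * realRep ρ (1 ⊗ₜ x) = realRep ρ (1 ⊗ₜ CliffordAlgebra.involute x) * f := by
  induction x using CliffordAlgebra.induction with
  | algebraMap r =>
    have : (1 : ℂ) ⊗ₜ[ℝ] algebraMap ℝ (Cl m) r = algebraMap ℝ (CCl m) r :=
      (Algebra.TensorProduct.includeRight : Cl m →ₐ[ℝ] CCl m).commutes r
    rw [AlgHom.commutes, this, AlgHom.commutes, Algebra.commutes]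
  | ι v =>
    rw [CliffordAlgebra.involute_ι, TensorProduct.tmul_neg, map_neg, neg_mul]
    exact hf v
  | mul a b ha hb =>
    have : ∀ a b : Cl m, (1 : ℂ) ⊗ₜ[ℝ] (a * b) = (1 ⊗ₜ a) * (1 ⊗ₜ b) := fun a b => by
      rw [Algebra.TensorProduct.tmul_mul_tmul, one_mul]
    rw [map_mul CliffordAlgebra.involute, this, this, map_mul, map_mul, ← mul_assoc, ha, mul_assoc,
      hb, mul_assoc]
  | add a b ha hb => rw [map_add, TensorProduct.tmul_add, TensorProduct.tmul_add, map_add, map_add,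
      mul_add, add_mul, ha, hb]

theorem apply_tmul (z : ℂ) (x : Cl m) (s : S) : ρ (z ⊗ₜ x) s = z • ρ (1 ⊗ₜ x) s := by
  have : z ⊗ₜ[ℝ] x = z • ((1 : ℂ) ⊗ₜ[ℝ] x) := by
    rw [TensorProduct.smul_tmul', smul_eq_mul, mul_one]
  rw [this, map_smul]
  rfl

/-- Schur's lemma for the spinor representation. -/
theorem IsSpinorRep.schur [FiniteDimensional ℂ S] {ρ : CCl m →ₐ[ℂ] (S →L[ℂ] S)}
    (hρ : IsSpinorRep ρ) {f : S →L[ℝ] S} (hI : f * mulI S = mulI S * f)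
    (hf : ∀ v, f * cliff ρ v = cliff ρ v * f) : ∃ c : ℂ, ∀ s, f s = c • s := by
  have := hρ.nontrivial
  let F : S →ₗ[ℂ] S :=
    { toFun := f
      map_add' := map_add f
      map_smul' := map_smul_of_commute hI }
  obtain ⟨c, hc⟩ := Module.End.exists_eigenvalue F
  refine ⟨c, fun s => ?_⟩
  -- The eigenspace is a subrepresentation; irreducibility makes it everything.
  have hinv : ∀ a : CCl m, ∀ s ∈ Module.End.eigenspace F c, ρ a s ∈ Module.End.eigenspace F c := by
    intro a s hs
    have hs' : f s = c • s := Module.End.mem_eigenspace_iff.mp hs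
    refine Module.End.mem_eigenspace_iff.mpr ?_
    change f (ρ a s) = c • ρ a s
    induction a using TensorProduct.induction_on with
    | zero => simp
    | tmul z x =>
      have h : f (ρ (1 ⊗ₜ x) s) = ρ (1 ⊗ₜ x) (f s) :=
        congrArg (fun g : S →L[ℝ] S => g s) (commute_realRep ρ hf x)
      rw [apply_tmul, map_smul_of_commute hI, h, hs', map_smul, smul_comm]
    | add a b ha hb => rw [map_add, add_apply, map_add, ha, hb, smul_add]
  rcases hρ.irreducible _ hinv with h | h
  · exact absurd h hc
  · exact Module.End.mem_eigenspace_iff.mp (h ▸ Submodule.mem_top : s ∈ Module.End.eigenspace F c)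

end Rep

/-! ### The antilinear operator `J` -/

/-- The number `2n + 1` of odd-numbered generators is odd. An even-numbered generator commutes with
`C` and gets a sign from each of them; an odd-numbered one gets a sign from `C` and from the `2n`
others. Either way the total sign is `-1`. -/
theorem exists_antilinear [FiniteDimensional ℂ S] {n : ℕ}
    {ρ : CCl (4 * n + 2) →ₐ[ℂ] (S →L[ℂ] S)} (hρ : IsSpinorRep ρ) :
    ∃ J : S →L[ℝ] S, J * mulI S = -(mulI S * J) ∧ (∀ v, J * cliff ρ v = -(cliff ρ v * J)) ∧
      J * J = (-1 : ℤ) ^ n • 1 ∧ IsRealAdjoint J ((-1 : ℤ) ^ n • J) := by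
  have := hρ.nontrivial
  have he := isCliffordSystem hρ (N := 2 * n + 1) (by omega)
  obtain ⟨C, hI, hadj, heven, hodd, s₀, hs₀, hCs₀⟩ := he.exists_conj
  set e : ℕ → S →L[ℝ] S := fun j => cliff ρ (stdVec (4 * n + 2) j)
  have hlin : ∀ a : ℕ, e a = cliff ρ (stdVec (4 * n + 2) a) := fun _ => rfl
  -- `C²` is complex linear and commutes with all generators, hence is a scalar; the fixed vector
  -- `s₀` shows that the scalar is `1`.
  have hCC : C * C = 1 := by
    have hc1 : C * C * mulI S = mulI S * (C * C) := by
      rw [mul_assoc, hI, mul_neg, ← mul_assoc, hI, neg_mul, neg_neg, mul_assoc]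
    have hc2 : ∀ v, C * C * cliff ρ v = cliff ρ v * (C * C) := by
      have : (LinearMap.mulLeft ℝ (C * C)) ∘ₗ cliff ρ =
          (LinearMap.mulRight ℝ (C * C)) ∘ₗ cliff ρ := by
        refine eq_of_stdVec fun j hj => ?_
        change C * C * e j = e j * (C * C)
        obtain ⟨k, rfl | rfl⟩ := Nat.even_or_odd' j
        · rw [mul_assoc, heven k (by omega), ← mul_assoc, heven k (by omega), mul_assoc]
        · rw [mul_assoc, hodd k (by omega), mul_neg, ← mul_assoc, hodd k (by omega), neg_mul,
            neg_neg, mul_assoc]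
      exact fun v => LinearMap.congr_fun this v
    obtain ⟨c, hc⟩ := hρ.schur hc1 hc2
    have h1 := hc s₀
    rw [mul_apply_eq_comp, hCs₀, hCs₀] at h1
    have h2 : (1 - c) • s₀ = 0 := by rw [sub_smul, one_smul, ← h1, sub_self]
    have h3 : c = 1 := by
      rcases smul_eq_zero.mp h2 with h | h
      · exact (sub_eq_zero.mp h).symm
      · exact absurd h hs₀
    ext s
    rw [hc, h3, one_smul]
    rfl
  have hA : ∀ j < 2 * n + 1, C * e (2 * j + 1) = (-1 : ℤ) ^ 1 • (e (2 * j + 1) * C) :=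
    fun j hj => by rw [hodd j hj, pow_one, neg_one_smul]
  have hanti : ∀ i j : ℕ, i ≠ j → e (2 * i + 1) * e (2 * j + 1) = -(e (2 * j + 1) * e (2 * i + 1)) :=
    fun i j h => he.anti _ _ (by omega)
  refine ⟨mulSeq C (fun k => e (2 * k + 1)) (2 * n + 1), ?_, ?_, ?_, ?_⟩
  · have : ∀ k, mulSeq C (fun k => e (2 * k + 1)) k * mulI S =
        -(mulI S * mulSeq C (fun k => e (2 * k + 1)) k) := by
      intro k
      induction k with
      | zero => exact hI
      | succ k ih => rw [mulSeq, mul_assoc, he.comm, ← mul_assoc, ih, neg_mul, mul_assoc]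
    exact this _
  · have : (LinearMap.mulLeft ℝ (mulSeq C (fun k => e (2 * k + 1)) (2 * n + 1))) ∘ₗ cliff ρ =
        -((LinearMap.mulRight ℝ (mulSeq C (fun k => e (2 * k + 1)) (2 * n + 1))) ∘ₗ cliff ρ) := by
      refine eq_of_stdVec fun j hj => ?_
      change mulSeq C _ (2 * n + 1) * e j = -(e j * mulSeq C _ (2 * n + 1))
      obtain ⟨k, rfl | rfl⟩ := Nat.even_or_odd' j
      · rw [mulSeq_mul_of_anticomm (t := 0) (by simpa using heven k (by omega))
          fun i _ => he.anti _ _ (by omega), zero_add, Odd.neg_one_pow (odd_two_mul_add_one n),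
          neg_one_smul]
      · rw [mulSeq_mul_self_of_lt (e := fun k => e (2 * k + 1)) (j := k) (hA k (by omega))
          (fun i h => hanti i k h) (by omega),
          Odd.neg_one_pow ⟨n + 1, by omega⟩, neg_one_smul]
    exact fun v => LinearMap.congr_fun this v
  · rw [mulSeq_sq (e := fun k => e (2 * k + 1)) hA hanti fun j hj => he.sq _ (by omega),
      neg_one_pow_sum_range, hCC]
  · have h := mulSeq_isRealAdjoint (e := fun k => e (2 * k + 1)) (k := 2 * n + 1) hadj hA hanti
      fun j => he.skew _
    rwa [neg_one_pow_sum_range] at h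

end Spinor
end SpinCLine

/-! ### The grading and the line of antilinear anticommuting operators -/

namespace SpinCLine

section Grading

theorem prod_ofFn_eq_mulSeq {R : Type*} [Ring R] (f : ℕ → R) (k : ℕ) :
    (List.ofFn fun j : Fin k => f j).prod = mulSeq 1 f k := by
  induction k with
  | zero => rfl
  | succ k ih =>
    rw [List.ofFn_succ', List.concat_eq_append, List.prod_append, List.prod_singleton, mulSeq, ← ih]
    rfl

theorem map_mulSeq {R R' : Type*} [Ring R] [Ring R'] (φ : R →+* R') (A : R) (f : ℕ → R) (k : ℕ) :
    φ (mulSeq A f k) = mulSeq (φ A) (fun j => φ (f j)) k := by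
  induction k with
  | zero => rfl
  | succ k ih => rw [mulSeq, map_mul, ih, mulSeq]

variable {S : Type*} [NormedAddCommGroup S] [InnerProductSpace ℂ S]

/-- The Clifford volume element `ρ(e_1 ⋯ e_m)`. -/
def volEl {m : ℕ} (ρ : CCl m →ₐ[ℂ] (S →L[ℂ] S)) : S →L[ℝ] S :=
  mulSeq 1 (fun j => cliff ρ (stdVec m j)) m

/-- The grading operator as a real endomorphism. -/
def realGrading {m : ℕ} (ρ : CCl m →ₐ[ℂ] (S →L[ℂ] S)) : S →L[ℝ] S :=
  (grading ρ).restrictScalars ℝ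

@[simp] theorem realGrading_apply {m : ℕ} (ρ : CCl m →ₐ[ℂ] (S →L[ℂ] S)) (s : S) :
    realGrading ρ s = grading ρ s := rfl

/-- Antilinear real endomorphisms which anticommute with Clifford multiplication. -/
structure IsAntiCliff {m : ℕ} (ρ : CCl m →ₐ[ℂ] (S →L[ℂ] S)) (F : S →L[ℝ] S) : Prop where
  antilinear : F * mulI S = -(mulI S * F)
  anticomm : ∀ v, F * cliff ρ v = -(cliff ρ v * F)

variable {n : ℕ} (ρ : CCl (4 * n + 2) →ₐ[ℂ] (S →L[ℂ] S))

theorem volEl_apply (s : S) : volEl ρ s =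
    ρ (List.ofFn fun j : Fin (4 * n + 2) =>
      vec (4 * n + 2) (EuclideanSpace.single j (1 : ℝ))).prod s := by
  have h : (List.ofFn fun j : Fin (4 * n + 2) =>
      vec (4 * n + 2) (EuclideanSpace.single j (1 : ℝ))).prod =
      mulSeq 1 (fun j => vec (4 * n + 2) (stdVec (4 * n + 2) j)) (4 * n + 2) := by
    rw [← prod_ofFn_eq_mulSeq]
    simp [stdVec]
  have h2 := map_mulSeq (realRep ρ : CCl (4 * n + 2) →+* (S →L[ℝ] S)) 1
    (fun j => vec (4 * n + 2) (stdVec (4 * n + 2) j)) (4 * n + 2)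
  rw [map_one] at h2
  rw [h]
  exact (congrArg (fun g : S →L[ℝ] S => g s) h2).symm

/-- The factor is `i^{2n+1} = (-1)^n i`. -/
theorem realGrading_eq : realGrading ρ = (-1 : ℤ) ^ n • (mulI S * volEl ρ) := by
  ext s
  have h : Complex.I ^ ((4 * n + 2) / 2) = ((-1 : ℤ) ^ n : ℤ) * Complex.I := by
    rw [show (4 * n + 2) / 2 = 2 * n + 1 by omega, pow_succ, pow_mul, Complex.I_sq]
    simp
  rw [realGrading_apply, grading, h, mul_smul, Int.cast_smul_eq_zsmul]
  change (-1 : ℤ) ^ n • (Complex.I • _) = (-1 : ℤ) ^ n • (Complex.I • volEl ρ s)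
  rw [volEl_apply]
  rfl

theorem volEl_mul_mulI : volEl ρ * mulI S = mulI S * volEl ρ := by
  ext s
  rw [mul_apply_eq_comp, mul_apply_eq_comp, volEl_apply, mulI_apply, mulI_apply, volEl_apply,
    map_smul]

theorem volEl_mul_of_anticomm {F : S →L[ℝ] S} (hF : ∀ v, F * cliff ρ v = -(cliff ρ v * F)) :
    volEl ρ * F = F * volEl ρ := by
  have h := mulSeq_mul_of_anticomm (A := 1) (e := fun j => cliff ρ (stdVec (4 * n + 2) j)) (x := F)
    (t := 0) (k := 4 * n + 2) (by simp) fun i _ => by rw [hF, neg_neg]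
  rwa [Even.neg_one_pow ⟨2 * n + 1, by omega⟩, one_smul] at h

theorem volEl_mul_cliff (v : Euc (4 * n + 2)) : volEl ρ * cliff ρ v = -(cliff ρ v * volEl ρ) := by
  have : (LinearMap.mulLeft ℝ (volEl ρ)) ∘ₗ cliff ρ =
      -((LinearMap.mulRight ℝ (volEl ρ)) ∘ₗ cliff ρ) := by
    refine eq_of_stdVec fun j hj => ?_
    have h := mulSeq_mul_self_of_lt (A := 1) (e := fun j => cliff ρ (stdVec (4 * n + 2) j))
      (t := 0) (by simp) (fun i hi => cliff_anticomm ρ (inner_stdVec hi)) hj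
    rwa [Odd.neg_one_pow ⟨2 * n + 1, by omega⟩, neg_one_smul] at h
  exact LinearMap.congr_fun this v

theorem volEl_sq : volEl ρ * volEl ρ = -1 := by
  have h := mulSeq_sq (A := 1) (e := fun j => cliff ρ (stdVec (4 * n + 2) j)) (t := 0)
    (k := 4 * n + 2) (by simp) (fun i j hi => cliff_anticomm ρ (inner_stdVec hi))
    fun j hj => by simp [cliff_mul_self, norm_stdVec hj]
  have h2 : ∑ i ∈ Finset.range (4 * n + 2), i = (2 * n + 1) * (4 * n + 1) := by
    have h := Finset.sum_range_id_mul_two (4 * n + 2)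
    rw [show 4 * n + 2 - 1 = 4 * n + 1 by omega] at h
    nlinarith
  -- The exponent is `(4n + 2) + (2n + 1)(4n + 1) = 2(4n² + 5n + 1) + 1`.
  rw [h2, Odd.neg_one_pow ⟨4 * n ^ 2 + 5 * n + 1, by ring⟩, neg_one_smul, one_mul] at h
  exact h

theorem realGrading_sq : realGrading ρ * realGrading ρ = 1 := by
  have h : mulI S * volEl ρ * (mulI S * volEl ρ) = 1 := by
    rw [mul_assoc, ← mul_assoc (volEl ρ), volEl_mul_mulI, mul_assoc, volEl_sq, ← mul_assoc,
      mulI_mul_mulI]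
    noncomm_ring
  rw [realGrading_eq, smul_mul_smul_comm, h, ← mul_pow]
  simp

theorem realGrading_mul_cliff (v : Euc (4 * n + 2)) :
    realGrading ρ * cliff ρ v = -(cliff ρ v * realGrading ρ) := by
  rw [realGrading_eq, smul_mul_assoc, mul_smul_comm, mul_assoc, volEl_mul_cliff, mul_neg,
    ← mul_assoc, ← mul_assoc, smul_neg]
  congr 3
  exact (realRep_mul_mulI ρ _).symm

variable {ρ}

theorem IsAntiCliff.realGrading {F : S →L[ℝ] S} (hF : IsAntiCliff ρ F) :
    F * realGrading ρ = -(realGrading ρ * F) := by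
  rw [realGrading_eq, smul_mul_assoc, mul_smul_comm, ← mul_assoc, hF.antilinear, neg_mul, mul_assoc,
    mul_assoc, volEl_mul_of_anticomm ρ hF.anticomm, smul_neg]

/-- Endomorphisms of odd degree that anticommute with Clifford multiplication are antilinear. -/
theorem isAntiCliff_of_odd {F : S →L[ℝ] S} (hF : ∀ v, F * cliff ρ v = -(cliff ρ v * F))
    (hG : F * realGrading ρ = -(realGrading ρ * F)) : IsAntiCliff ρ F where
  anticomm := hF
  antilinear := by
    rw [realGrading_eq, smul_mul_assoc, mul_smul_comm, ← smul_neg] at hG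
    have h : F * (mulI S * volEl ρ) = -(mulI S * volEl ρ * F) := by
      have := congrArg (fun x : S →L[ℝ] S => (-1 : ℤ) ^ n • x) hG
      simpa only [smul_smul, ← mul_pow, neg_mul_neg, one_mul, one_pow, one_smul] using this
    rw [mul_assoc (mulI S), volEl_mul_of_anticomm ρ hF] at h
    -- The volume element now stands on the right on both sides and is cancelled through its
    -- inverse, its negative.
    have h2 := congrArg (fun x : S →L[ℝ] S => -(x * volEl ρ)) h
    simp only [neg_mul, mul_assoc, volEl_sq, neg_neg] at h2
    simpa using h2

theorem IsAntiCliff.apply_smul {F : S →L[ℝ] S} (hF : IsAntiCliff ρ F) (z : ℂ) (s : S) :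
    F (z • s) = (starRingEnd ℂ z) • F s :=
  map_smul_of_anticommute hF.antilinear z s

theorem IsAntiCliff.smul {F : S →L[ℝ] S} (hF : IsAntiCliff ρ F) (z : ℂ) :
    IsAntiCliff ρ (z • F) where
  antilinear := by
    ext s
    change z • F (Complex.I • s) = -(Complex.I • z • F s)
    rw [hF.apply_smul, smul_smul, smul_smul, Complex.conj_I, mul_neg, neg_smul, mul_comm]
  anticomm v := by
    ext s
    change z • (F * cliff ρ v) s = -(cliff ρ v (z • F s))
    rw [hF.anticomm, cliff_apply, map_smul, ← smul_neg]
    rfl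

theorem IsAntiCliff.smul_mul_smul {F : S →L[ℝ] S} (hF : IsAntiCliff ρ F) (z : ℂ) :
    (z • F) * (z • F) = (‖z‖ ^ 2 : ℝ) • (F * F) := by
  ext s
  change z • F (z • F s) = (‖z‖ ^ 2 : ℝ) • F (F s)
  rw [hF.apply_smul, smul_smul, Complex.mul_conj, Complex.normSq_eq_norm_sq, Complex.coe_smul]

/-- Moving `z` across the inner product conjugates it, and the antilinear `F` conjugates it back; so
a complex multiple has the same symmetry type as `F`. -/
theorem IsAntiCliff.isRealAdjoint_smul {F : S →L[ℝ] S} (hF : IsAntiCliff ρ F) {k : ℕ}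
    (hadj : IsRealAdjoint F ((-1 : ℤ) ^ k • F)) (z : ℂ) :
    IsRealAdjoint (z • F) ((-1 : ℤ) ^ k • z • F) := fun s t => by
  have h1 : inner ℂ ((z • F) s) t = inner ℂ (F s) ((starRingEnd ℂ z) • t) := by
    rw [inner_smul_right]
    exact inner_smul_left _ _ _
  have h2 : ((-1 : ℤ) ^ k • F) ((starRingEnd ℂ z) • t) = ((-1 : ℤ) ^ k • z • F) t := by
    change (-1 : ℤ) ^ k • F _ = (-1 : ℤ) ^ k • z • F t
    rw [hF.apply_smul, Complex.conj_conj]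
  rw [h1, hadj, h2]

/-- Uniqueness of the antilinear operator, up to complex multiples. -/
theorem IsAntiCliff.exists_smul_eq [FiniteDimensional ℂ S] (hρ : IsSpinorRep ρ) {F J : S →L[ℝ] S}
    (hF : IsAntiCliff ρ F) (hJ : IsAntiCliff ρ J) {r : ℝ} (hr : r ≠ 0) (hJJ : J * J = r • 1) :
    ∃ c : ℂ, F = c • J := by
  obtain ⟨c, hc⟩ := hρ.schur (f := F * J)
    (by rw [mul_assoc, hJ.antilinear, mul_neg, ← mul_assoc, hF.antilinear, neg_mul, neg_neg,
      mul_assoc])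
    (fun v => by rw [mul_assoc, hJ.anticomm, mul_neg, ← mul_assoc, hF.anticomm, neg_mul, neg_neg,
      mul_assoc])
  -- With `F J = c`, evaluation at `J s` gives `r F s = c J s`.
  refine ⟨(r⁻¹ : ℝ) * c, ?_⟩
  ext s
  have h1 := hc (J s)
  have h2 : J (J s) = r • s := congrArg (fun g : S →L[ℝ] S => g s) hJJ
  rw [mul_apply_eq_comp, h2, map_smul] at h1
  change F s = ((r⁻¹ : ℝ) * c : ℂ) • J s
  rw [mul_smul, ← h1, Complex.coe_smul, smul_smul, inv_mul_cancel₀ hr, one_smul]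

/-! ### Construction of the extended action -/

theorem add_add_sq {R : Type*} [Ring R] [Algebra ℝ R] {a b c : R} {x y z : ℝ} (hab : a * b = -(b * a))
    (hca : c * a = -(a * c)) (hcb : c * b = -(b * c)) (ha : a * a = algebraMap ℝ R x)
    (hb : b * b = algebraMap ℝ R y) (hc : c * c = algebraMap ℝ R z) :
    (a + b + c) * (a + b + c) = algebraMap ℝ R (x + (y + z)) := by
  have : (a + b + c) * (a + b + c) = a * a + (a * b + b * a) + b * b + (c * a + a * c) +
    (c * b + b * c) + c * c := by noncomm_ring
  rw [this, hab, hca, hcb, ha, hb, hc, map_add, map_add]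
  abel

/-- The action of the generators of `Cl_3`, given an antilinear operator `J`. -/
def extendedGen (ρ : CCl (4 * n + 2) →ₐ[ℂ] (S →L[ℂ] S)) (J : S →L[ℝ] S) :
    Euc (4 * n + 2) × ℝ × ℂ →ₗ[ℝ] (S →L[ℝ] S) where
  toFun p := cliff ρ p.1 + p.2.1 • realGrading ρ + p.2.2 • J
  map_add' p q := by
    ext s
    simp only [Prod.fst_add, Prod.snd_add, map_add, add_smul, add_apply]
    abel
  map_smul' c p := by
    ext s
    simp only [Prod.smul_fst, Prod.smul_snd, map_smul, RingHom.id_apply, smul_add, smul_assoc]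

theorem extendedGen_apply (J : S →L[ℝ] S) (v : Euc (4 * n + 2)) (t : ℝ) (z : ℂ) :
    extendedGen ρ J (v, t, z) = cliff ρ v + t • realGrading ρ + z • J := rfl

/-- The three summands anticommute pairwise, so only their squares remain. -/
theorem extendedGen_sq {J : S →L[ℝ] S} (hJ : IsAntiCliff ρ J) (hJJ : J * J = (-1 : ℤ) ^ n • 1)
    (p : Euc (4 * n + 2) × ℝ × ℂ) :
    extendedGen ρ J p * extendedGen ρ J p = algebraMap ℝ _ (form3 n p) := by
  obtain ⟨v, t, z⟩ := p
  rw [extendedGen_apply, form3_apply]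
  have hz := hJ.smul z
  refine add_add_sq ?_ (hz.anticomm v) ?_ ?_ ?_ ?_
  · rw [mul_smul_comm t, smul_mul_assoc t, realGrading_mul_cliff, smul_neg, neg_neg]
  · rw [mul_smul_comm t, smul_mul_assoc t, hz.realGrading, smul_neg]
  · rw [cliff_mul_self, Algebra.algebraMap_eq_smul_one]
  · rw [smul_mul_smul_comm, realGrading_sq, Algebra.algebraMap_eq_smul_one, pow_two]
  · rw [hJ.smul_mul_smul, hJJ, Algebra.algebraMap_eq_smul_one, ← Int.cast_smul_eq_zsmul ℝ,
      smul_smul, mul_comm]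
    simp

/-- The extended action of `Cl_3`. -/
def extendedRep {J : S →L[ℝ] S} (hJ : IsAntiCliff ρ J) (hJJ : J * J = (-1 : ℤ) ^ n • 1) :
    Cl3 n →ₐ[ℝ] (S →L[ℝ] S) :=
  CliffordAlgebra.lift (form3 n) ⟨extendedGen ρ J, extendedGen_sq hJ hJJ⟩

theorem extendedRep_ι {J : S →L[ℝ] S} (hJ : IsAntiCliff ρ J) (hJJ : J * J = (-1 : ℤ) ^ n • 1)
    (p : Euc (4 * n + 2) × ℝ × ℂ) :
    extendedRep hJ hJJ (CliffordAlgebra.ι (form3 n) p) = extendedGen ρ J p :=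
  CliffordAlgebra.lift_ι_apply (extendedGen ρ J) (extendedGen_sq hJ hJJ) p

theorem adZ2_ι (l : SpinC (4 * n + 2)) (v : Euc (4 * n + 2)) (t : ℝ) (z : ℂ) :
    adZ2 n l (CliffordAlgebra.ι (form3 n) (v, t, z)) =
      CliffordAlgebra.ι (form3 n) (Ad l v, t, detChar l * z) :=
  CliffordAlgebra.map_apply_ι _ _

theorem cliff_Ad_mul (l : SpinC (4 * n + 2)) (v : Euc (4 * n + 2)) :
    cliff ρ (Ad l v) * realRep ρ (spinVal l) = realRep ρ (spinVal l) * cliff ρ v := by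
  change realRep ρ (vec _ (Ad l v)) * _ = _ * realRep ρ (vec _ v)
  rw [vec_Ad, ← map_mul, ← map_mul, mul_assoc _ (spinVal l⁻¹), spinVal_inv_mul, mul_one]

theorem realGrading_mul_spinVal (l : SpinC (4 * n + 2)) :
    realGrading ρ * realRep ρ (spinVal l) = realRep ρ (spinVal l) * realGrading ρ := by
  obtain ⟨⟨μ, u⟩, rfl⟩ := exists_rep l
  have h := anticommute_realRep ρ (realGrading_mul_cliff ρ) (μ : Cl (4 * n + 2))
  rw [spinGroup.involute_eq μ.2] at h
  ext s
  change grading ρ (ρ (spinVal (spinMk μ u)) s) = ρ (spinVal (spinMk μ u)) (grading ρ s)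
  have h' : grading ρ (ρ (1 ⊗ₜ (μ : Cl (4 * n + 2))) s) = ρ (1 ⊗ₜ (μ : Cl (4 * n + 2))) (grading ρ s) :=
    congrArg (fun g : S →L[ℝ] S => g s) h
  rw [spinVal_mk, apply_tmul ρ u _ s, apply_tmul ρ u _ (grading ρ s), map_smul, h']

/-- `J` commutes with the even element `μ` and conjugates the phase `u`; the character supplies
`u²`, and `u² ū = u`. -/
theorem IsAntiCliff.mul_spinVal {J : S →L[ℝ] S} (hJ : IsAntiCliff ρ J) (l : SpinC (4 * n + 2))
    (z : ℂ) :
    ((detChar l * z) • J) * realRep ρ (spinVal l) = realRep ρ (spinVal l) * (z • J) := by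
  obtain ⟨⟨μ, u⟩, rfl⟩ := exists_rep l
  have h := anticommute_realRep ρ hJ.anticomm (μ : Cl (4 * n + 2))
  rw [spinGroup.involute_eq μ.2] at h
  ext s
  change (detChar (spinMk μ u) * z) • J (ρ (spinVal (spinMk μ u)) s) =
    ρ (spinVal (spinMk μ u)) (z • J s)
  have h' : J (ρ (1 ⊗ₜ (μ : Cl (4 * n + 2))) s) = ρ (1 ⊗ₜ (μ : Cl (4 * n + 2))) (J s) :=
    congrArg (fun g : S →L[ℝ] S => g s) h
  have hu : (u : ℂ) * (starRingEnd ℂ) u = 1 := by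
    rw [Complex.mul_conj, Circle.normSq_coe, Complex.ofReal_one]
  rw [spinVal_mk, apply_tmul ρ u _ s, apply_tmul ρ u _ (z • J s), hJ.apply_smul, h', map_smul, smul_smul, smul_smul,
    detChar_mk]
  congr 1
  linear_combination (u * z : ℂ) * hu

theorem isExtendedAction_extendedRep {J : S →L[ℝ] S} (hJ : IsAntiCliff ρ J)
    (hJJ : J * J = (-1 : ℤ) ^ n • 1) : IsExtendedAction ρ (extendedRep hJ hJJ) where
  restrict v s := by
    rw [extendedRep_ι, extendedGen_apply, zero_smul, zero_smul, add_zero, add_zero, cliff_apply]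
  grading s := by
    rw [extendedRep_ι, extendedGen_apply, zero_smul, one_smul, add_zero, map_zero, zero_add,
      realGrading_apply]
  equivariant l a s := by
    suffices h : extendedRep hJ hJJ (adZ2 n l a) * realRep ρ (spinVal l) =
        realRep ρ (spinVal l) * extendedRep hJ hJJ a from
      congrArg (fun g : S →L[ℝ] S => g s) h
    induction a using CliffordAlgebra.induction with
    | algebraMap r => rw [AlgHom.commutes, AlgHom.commutes, Algebra.commutes]
    | ι p =>
      obtain ⟨v, t, z⟩ := p
      rw [adZ2_ι, extendedRep_ι, extendedRep_ι, extendedGen_apply, extendedGen_apply, add_mul,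
        add_mul, cliff_Ad_mul, smul_mul_assoc, realGrading_mul_spinVal, hJ.mul_spinVal, mul_add,
        mul_add, mul_smul_comm t]
    | mul a b ha hb =>
      rw [map_mul, map_mul, map_mul, mul_assoc, hb, ← mul_assoc, ha, mul_assoc]
    | add a b ha hb => rw [map_add, map_add, map_add, add_mul, mul_add, ha, hb]

/-! ### Properties of every extended action -/

namespace IsExtendedAction

variable {ρ' : Cl3 n →ₐ[ℝ] (S →L[ℝ] S)} (h : IsExtendedAction ρ ρ')
include h

theorem etaAction_equivariant (l : SpinC (4 * n + 2)) (z : ℂ) (s : S) :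
    etaAction ρ' (detChar l * z) (ρ (spinVal l) s) = ρ (spinVal l) (etaAction ρ' z s) := by
  have := h.equivariant l (CliffordAlgebra.ι (form3 n) (0, 0, z)) s
  rw [adZ2_ι, map_zero] at this
  exact this

/-- This is equivariance under the central elements `[1, u]`, which act on spinors by `u` and on `η`
by `u²`. -/
theorem etaAction_circle (u : Circle) (z : ℂ) (s : S) :
    etaAction ρ' ((u : ℂ) ^ 2 * z) ((u : ℂ) • s) = (u : ℂ) • etaAction ρ' z s := by
  have := h.etaAction_equivariant (spinMk 1 u) z s
  rw [detChar_mk, spinVal_mk, apply_tmul ρ u _ s, apply_tmul ρ u _ (etaAction ρ' z s)] at this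
  have h1 : (1 : ℂ) ⊗ₜ[ℝ] ((1 : Spin (4 * n + 2)) : Cl (4 * n + 2)) = (1 : CCl (4 * n + 2)) := rfl
  rw [h1, map_one] at this
  exact this

/-- Antilinearity is equivariance under the phase `u = i`, for which `u² = -1`. Anticommutation is
the Clifford relation for orthogonal generators. -/
theorem isAntiCliff_etaAction (z : ℂ) : IsAntiCliff ρ (etaAction ρ' z) where
  antilinear := by
    ext s
    have h1 := h.etaAction_circle ⟨Complex.I, by simp [Submonoid.unitSphere]⟩ z s
    change etaAction ρ' (Complex.I ^ 2 * z) (Complex.I • s) = Complex.I • etaAction ρ' z s at h1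
    rw [Complex.I_sq, neg_one_mul, map_neg] at h1
    exact neg_eq_iff_eq_neg.mp h1
  anticomm v := by
    have hv : cliff ρ v = ρ' (CliffordAlgebra.ι (form3 n) (v, 0, 0)) := by
      ext s
      exact (h.restrict v s).symm
    have hz : etaAction ρ' z = ρ' (CliffordAlgebra.ι (form3 n) (0, 0, z)) := rfl
    have h1 := CliffordAlgebra.ι_mul_ι_add_swap (Q := form3 n) (0, 0, z) (v, 0, 0)
    have h2 : QuadraticMap.polar (form3 n) (0, 0, z) (v, 0, 0) = 0 := by
      simp only [QuadraticMap.polar, Prod.mk_add_mk, form3_apply]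
      simp
    rw [h2, map_zero] at h1
    rw [hv, hz, ← map_mul ρ', ← map_mul ρ', ← map_neg, eq_neg_of_add_eq_zero_left h1]

/-- Antilinearity turns the phase relation into linearity for factors `u²`. Every `z` is `‖z‖ u²`
with `u` a square root of its phase, and real factors are already covered. -/
theorem etaAction_mul (z w : ℂ) : etaAction ρ' (z * w) = z • etaAction ρ' w := by
  ext s
  change etaAction ρ' (z * w) s = z • etaAction ρ' w s
  set u : Circle := Circle.exp (z.arg / 2) with hu
  have hu2 : (u : ℂ) ^ 2 = Complex.exp (z.arg * Complex.I) := by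
    rw [hu, Circle.coe_exp, ← Complex.exp_nat_mul]
    congr 1
    push_cast
    ring
  have huu : (starRingEnd ℂ) u * (u : ℂ) = 1 := by
    rw [mul_comm, Complex.mul_conj, Circle.normSq_coe, Complex.ofReal_one]
  have hz : z * w = ‖z‖ • ((u : ℂ) ^ 2 * w) := by
    rw [hu2, Complex.real_smul, ← mul_assoc, Complex.norm_mul_exp_arg_mul_I]
  have h1 := h.etaAction_circle u w ((starRingEnd ℂ) (u : ℂ) • s)
  rw [smul_smul, mul_comm (u : ℂ), huu, one_smul, (h.isAntiCliff_etaAction w).apply_smul,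
    Complex.conj_conj, smul_smul, ← pow_two] at h1
  rw [hz, map_smul]
  change ‖z‖ • etaAction ρ' _ s = _
  rw [h1, ← Complex.coe_smul, smul_smul, hu2, Complex.norm_mul_exp_arg_mul_I]

omit h in
theorem etaAction_sq (z : ℂ) :
    etaAction ρ' z * etaAction ρ' z = ((-1) ^ n * ‖z‖ ^ 2 : ℝ) • 1 := by
  change ρ' (CliffordAlgebra.ι (form3 n) (0, 0, z)) * ρ' (CliffordAlgebra.ι (form3 n) (0, 0, z)) = _
  rw [← map_mul, CliffordAlgebra.ι_sq_scalar, AlgHom.commutes, form3_apply,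
    Algebra.algebraMap_eq_smul_one]
  simp

end IsExtendedAction
end Grading
end SpinCLine

namespace SpinCLine

/-! ### The action of `η` on a single fibre -/

section Fibre

variable {S : Type*} [NormedAddCommGroup S] [InnerProductSpace ℂ S] {n : ℕ}
  {ρ : CCl (4 * n + 2) →ₐ[ℂ] (S →L[ℂ] S)} {ρ' : Cl3 n →ₐ[ℝ] (S →L[ℝ] S)}

theorem etaAction_bijective {z : ℂ} (hz : z ≠ 0) : Function.Bijective (etaAction ρ' z) := by
  have h : ∀ s, etaAction ρ' z (etaAction ρ' z s) = ((-1) ^ n * ‖z‖ ^ 2 : ℝ) • s := fun s =>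
    congrArg (fun g : S →L[ℝ] S => g s) (IsExtendedAction.etaAction_sq (ρ' := ρ') z)
  have hr : ((-1) ^ n * ‖z‖ ^ 2 : ℝ) ≠ 0 := by simp [hz]
  refine ⟨fun s t hst => ?_, fun s => ⟨((-1) ^ n * ‖z‖ ^ 2 : ℝ)⁻¹ • etaAction ρ' z s, ?_⟩⟩
  · have h1 := h s
    rw [hst, h] at h1
    exact (smul_right_injective S hr h1).symm
  · rw [map_smul, h, smul_smul, inv_mul_cancel₀ hr, one_smul]

theorem etaAction_eq_zero_iff [Nontrivial S] {z : ℂ} : etaAction ρ' z = 0 ↔ z = 0 := by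
  refine ⟨fun h => ?_, fun h => by rw [h, map_zero]⟩
  by_contra hz
  obtain ⟨s, hs⟩ := exists_ne (0 : S)
  refine hs ((etaAction_bijective (ρ' := ρ') hz).1 ?_)
  rw [h]
  rfl

theorem etaAction_injective [Nontrivial S] : Function.Injective (etaAction ρ') :=
  (injective_iff_map_eq_zero _).mpr fun _ => etaAction_eq_zero_iff.mp

/-- An extended action is not assumed to respect the metric. The symmetry is inherited from `J`, of
which the action of `η` is a complex multiple by uniqueness. -/
theorem etaAction_isRealAdjoint [FiniteDimensional ℂ S] (hρ : IsSpinorRep ρ)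
    (h : IsExtendedAction ρ ρ') (z : ℂ) :
    IsRealAdjoint (etaAction ρ' z) ((-1 : ℤ) ^ n • etaAction ρ' z) := by
  obtain ⟨J, hI, hv, hJJ, hadj⟩ := exists_antilinear hρ
  have hJ : IsAntiCliff ρ J := ⟨hI, hv⟩
  obtain ⟨c, hc⟩ := (h.isAntiCliff_etaAction z).exists_smul_eq hρ hJ (r := (-1) ^ n) (by simp)
    (by rw [hJJ, ← Int.cast_smul_eq_zsmul ℝ]; simp)
  rw [hc]
  exact hJ.isRealAdjoint_smul hadj c

theorem exists_etaAction_eq [FiniteDimensional ℂ S] (hρ : IsSpinorRep ρ)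
    (h : IsExtendedAction ρ ρ') {F : S →L[ℝ] S} (hF : IsAntiCliff ρ F) :
    ∃ z, etaAction ρ' z = F := by
  obtain ⟨c, hc⟩ := hF.exists_smul_eq hρ (h.isAntiCliff_etaAction 1) (r := (-1) ^ n) (by simp)
    (by rw [IsExtendedAction.etaAction_sq]; simp)
  exact ⟨c, by rw [hc, ← h.etaAction_mul, mul_one]⟩

end Fibre

/-! ### Passage to the bundles and their sections -/

namespace SpinCStructure

variable {n : ℕ} {X : Type*} [TopologicalSpace X] [ChartedSpace (Euc (4 * n + 2)) X]
  [IsManifold 𝓘(ℝ, Euc (4 * n + 2)) ∞ X]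
  {g : Bundle.ContMDiffRiemannianMetric 𝓘(ℝ, Euc (4 * n + 2)) ∞ (Euc (4 * n + 2))
    (fun x : X => TangentSpace 𝓘(ℝ, Euc (4 * n + 2)) x)}
  {ι : Type*} (P : SpinCStructure g ι)
  {S : Type*} [NormedAddCommGroup S] [InnerProductSpace ℂ S]
  {ρ : CCl (4 * n + 2) →ₐ[ℂ] (S →L[ℂ] S)} {ρ' : Cl3 n →ₐ[ℝ] (S →L[ℝ] S)}

/-- Orthonormality of the frame makes every coordinate vector occur, so anticommuting with tangent
vectors is anticommuting with all of `ℝ^(4n+2)`. -/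
theorem exists_cliffordMul_eq (ρ : CCl (4 * n + 2) →ₐ[ℂ] (S →L[ℂ] S)) (x : X)
    (w : Euc (4 * n + 2)) :
    ∃ v : TangentSpace 𝓘(ℝ, Euc (4 * n + 2)) x,
      P.cliffordMul ρ x v = ρ (vec (4 * n + 2) w) := by
  refine ⟨P.frame (P.indexAt x) x w, ?_⟩
  rw [cliffordMul]
  congr 2
  ext j
  simp [P.frame_orthonormal _ x (P.mem_baseSet_at x), EuclideanSpace.inner_single_right]

theorem etaAction_mem_lineH [FiniteDimensional ℂ S] (hρ : IsSpinorRep ρ)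
    (h : IsExtendedAction ρ ρ') (x : X) (z : ℂ) :
    (P.extendedMul ρ ρ' x z : P.EndSpinor ρ x) ∈ P.lineH ρ x := by
  have hA := h.isAntiCliff_etaAction z
  refine ⟨fun s t => ?_, fun s => ?_, fun v s => ?_⟩
  · have h1 := etaAction_isRealAdjoint hρ h z s t
    have h2 : ((-1 : ℤ) ^ n • etaAction ρ' z) t = (((-1 : ℝ) ^ n : ℝ) : ℂ) • etaAction ρ' z t := by
      rw [Complex.coe_smul, ← Int.cast_one (R := ℝ), ← Int.cast_neg, ← Int.cast_pow, Int.cast_smul_eq_zsmul]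
      rfl
    rw [h2, inner_smul_right, Complex.re_ofReal_mul] at h1
    exact h1
  · exact congrArg (fun g : S →L[ℝ] S => g s) hA.realGrading
  · exact congrArg (fun g : S →L[ℝ] S => g s) (hA.anticomm _)

theorem isAntiCliff_of_mem_lineH {x : X} {f : P.EndSpinor ρ x} (hf : f ∈ P.lineH ρ x) :
    IsAntiCliff ρ (P.toModel ρ x f) := by
  obtain ⟨-, h2, h3⟩ := hf
  refine isAntiCliff_of_odd (fun w => ?_) ?_
  · obtain ⟨v, hv⟩ := P.exists_cliffordMul_eq ρ x w
    ext s
    have := h3 v s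
    rw [hv] at this
    exact this
  · ext s
    exact h2 s

theorem extendedMul_bijOn [FiniteDimensional ℂ S] (hρ : IsSpinorRep ρ)
    (h : IsExtendedAction ρ ρ') (x : X) :
    Set.BijOn (P.extendedMul ρ ρ' x) Set.univ (P.lineH ρ x) := by
  have := hρ.nontrivial
  refine ⟨fun z _ => P.etaAction_mem_lineH hρ h x z,
    (etaAction_injective (ρ' := ρ')).injOn, fun f hf => ?_⟩
  obtain ⟨z, hz⟩ := exists_etaAction_eq hρ h (P.isAntiCliff_of_mem_lineH hf)
  exact ⟨z, trivial, hz⟩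

/-- A change of trivialization acts by the transition element on spinors and by its character on the
line; equivariance under that element is the compatibility needed. -/
theorem localTriv_extendedMul (h : IsExtendedAction ρ ρ') {i : ι} {x : X} (z : ℂ) (s : S) :
    ρ (spinVal (P.trans i (P.indexAt x) x)) (etaAction ρ' z s) =
      etaAction ρ' ((P.detLineCore.localTriv i ⟨x, z⟩).2)
        (ρ (spinVal (P.trans i (P.indexAt x) x)) s) :=
  (h.etaAction_equivariant _ z s).symm

theorem isExtendedCliffordImage (h : IsExtendedAction ρ ρ') (σ : ∀ x, P.DetLine x) :
    P.IsExtendedCliffordImage ρ ρ' σ fun x => P.extendedMul ρ ρ' x (σ x) :=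
  fun _ x _ s => P.localTriv_extendedMul h (σ x) s

theorem inCoordinates_extendedMul (h : IsExtendedAction ρ ρ') {x₀ x : X}
    (hx : x ∈ P.baseSet (P.indexAt x₀)) (z : P.DetLine x) :
    ContinuousLinearMap.inCoordinates S (P.Spinor ρ) S (P.Spinor ρ) x₀ x x₀ x
        (P.extendedMul ρ ρ' x z) =
      etaAction ρ' (P.detLineCore.localTriv (P.indexAt x₀) ⟨x, z⟩).2 := by
  have h1 := VectorBundleCore.inCoordinates_eq (P.spinorCore ρ) (P.spinorCore ρ) (x₀ := x₀)
    (y₀ := x₀) (x := x) (y := x) (σ := RingHom.id ℝ) (etaAction ρ' z) hx hx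
  refine h1.trans ?_
  ext s
  refine (P.localTriv_extendedMul h (i := P.indexAt x₀) z _).trans ?_
  have h2 := (P.spinorCore ρ).coordChange_comp (P.indexAt x₀) (P.indexAt x) (P.indexAt x₀) x
    ⟨⟨hx, P.mem_baseSet_at x⟩, hx⟩ s
  rw [(P.spinorCore ρ).coordChange_self _ x hx] at h2
  exact congrArg _ h2

/-- Near `x₀` both sections are compared in the trivializations at `x₀`, where they differ by the
constant linear map `etaAction ρ'`. A linear left inverse of it gives the forward direction. -/
theorem contMDiff_extendedMul_iff [FiniteDimensional ℂ S] [Nontrivial S]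
    (h : IsExtendedAction ρ ρ') (k : ℕ∞) (σ : ∀ x, P.DetLine x) :
    ContMDiff 𝓘(ℝ, Euc (4 * n + 2)) (𝓘(ℝ, Euc (4 * n + 2)).prod 𝓘(ℝ, S →L[ℝ] S)) k
        (fun x => Bundle.TotalSpace.mk' (S →L[ℝ] S) (E := P.EndSpinor ρ) x
          (P.extendedMul ρ ρ' x (σ x))) ↔
      ContMDiff 𝓘(ℝ, Euc (4 * n + 2)) (𝓘(ℝ, Euc (4 * n + 2)).prod 𝓘(ℝ, ℂ)) k
        (fun x => Bundle.TotalSpace.mk' ℂ (E := P.DetLine) x (σ x)) := by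
  have : FiniteDimensional ℝ S := FiniteDimensional.complexToReal S
  refine forall_congr' fun x₀ => ?_
  have h1 := Bundle.contMDiffAt_section (IB := 𝓘(ℝ, Euc (4 * n + 2))) (n := (k : WithTop ℕ∞))
    (E := P.EndSpinor ρ) (F := S →L[ℝ] S) (s := fun x => P.extendedMul ρ ρ' x (σ x)) x₀
  have h2 := Bundle.contMDiffAt_section (IB := 𝓘(ℝ, Euc (4 * n + 2))) (n := (k : WithTop ℕ∞))
    (E := P.DetLine) (F := ℂ) (s := σ) x₀
  refine h1.trans (Iff.trans ?_ h2.symm)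
  have h3 : (fun x => (trivializationAt (S →L[ℝ] S) (P.EndSpinor ρ) x₀
      ⟨x, P.extendedMul ρ ρ' x (σ x)⟩).2) =ᶠ[nhds x₀]
      fun x => etaAction ρ' (trivializationAt ℂ P.DetLine x₀ ⟨x, σ x⟩).2 := by
    filter_upwards [(P.isOpen_baseSet _).mem_nhds (P.mem_baseSet_at x₀)] with x hx
    exact P.inCoordinates_extendedMul h hx (σ x)
  rw [h3.contMDiffAt_iff]
  constructor
  · intro hs
    obtain ⟨ψ, hψ⟩ := LinearMap.exists_leftInverse_of_injective (etaAction ρ')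
      (LinearMap.ker_eq_bot.mpr etaAction_injective)
    have := (LinearMap.toContinuousLinearMap ψ).contMDiff.contMDiffAt.comp x₀ hs
    refine this.congr_of_eventuallyEq (Filter.Eventually.of_forall fun x => ?_)
    exact (LinearMap.congr_fun hψ _).symm
  · intro hs
    exact (LinearMap.toContinuousLinearMap (etaAction ρ')).contMDiff.contMDiffAt.comp x₀ hs

/-- The bijection between the sections of `L_X` and of `L_H`. -/
def sectionEquiv [FiniteDimensional ℂ S] (hρ : IsSpinorRep ρ) (h : IsExtendedAction ρ ρ')
    (k : ℕ∞) : P.DetSection k ≃ {f : P.EndSection ρ k // ∀ x, f x ∈ P.lineH ρ x} :=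
  have := hρ.nontrivial
  Equiv.ofBijective
    (fun σ => ⟨⟨fun x => P.extendedMul ρ ρ' x (σ x),
      (P.contMDiff_extendedMul_iff h k σ).mpr σ.contMDiff⟩,
      fun x => P.etaAction_mem_lineH hρ h x (σ x)⟩) (by
    constructor
    · intro σ τ hst
      refine ContMDiffSection.ext fun x => ?_
      have h1 := congrArg (fun f => f.1 x) hst
      exact etaAction_injective (ρ' := ρ') h1
    · rintro ⟨f, hf⟩
      -- The preimage is chosen pointwise; its regularity is then forced by that of `f`.
      choose σ _ hσ using fun x => (P.extendedMul_bijOn hρ h x).surjOn (hf x)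
      have hfσ : ContMDiff 𝓘(ℝ, Euc (4 * n + 2))
          (𝓘(ℝ, Euc (4 * n + 2)).prod 𝓘(ℝ, S →L[ℝ] S)) k
          (fun x => Bundle.TotalSpace.mk' (S →L[ℝ] S) (E := P.EndSpinor ρ) x
            (P.extendedMul ρ ρ' x (σ x))) := by
        simp only [hσ]
        exact f.contMDiff
      refine ⟨⟨σ, (P.contMDiff_extendedMul_iff h k σ).mp hfσ⟩, Subtype.ext ?_⟩
      exact ContMDiffSection.ext fun x => hσ x)

theorem supp_extendedMul [Nontrivial S] (σ : ∀ x, P.DetLine x) :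
    P.supp ρ (fun x => P.extendedMul ρ ρ' x (σ x)) = P.zeroSet σ := by
  ext x
  change ¬ Function.Bijective (etaAction ρ' (σ x)) ↔ σ x = 0
  refine ⟨fun hb => by_contra fun hz => hb (etaAction_bijective hz), fun hz hb => ?_⟩
  obtain ⟨s, hs⟩ := exists_ne (0 : S)
  refine hs (hb.1 ?_)
  have h0 : etaAction ρ' (σ x) = 0 := etaAction_eq_zero_iff.mpr hz
  rw [h0]
  rfl

end SpinCStructure
end SpinCLine

theorem mainTheorem4 (n : ℕ)
    {S : Type*} [NormedAddCommGroup S] [InnerProductSpace ℂ S] [FiniteDimensional ℂ S]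
    (ρ : SpinCLine.CCl (4 * n + 2) →ₐ[ℂ] (S →L[ℂ] S)) (hρ : SpinCLine.IsSpinorRep ρ)
    {X : Type*} [TopologicalSpace X] [ChartedSpace (SpinCLine.Euc (4 * n + 2)) X]
    [IsManifold 𝓘(ℝ, SpinCLine.Euc (4 * n + 2)) ∞ X]
    (g : Bundle.ContMDiffRiemannianMetric 𝓘(ℝ, SpinCLine.Euc (4 * n + 2)) ∞
      (SpinCLine.Euc (4 * n + 2))
      (fun x : X => TangentSpace 𝓘(ℝ, SpinCLine.Euc (4 * n + 2)) x))
    {ι : Type*} (P : SpinCLine.SpinCStructure g ι) :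
    -- the spinor representation extends to a `Spin^c`-equivariant action of `Cl_3`
    (∃ ρ' : SpinCLine.Cl3 n →ₐ[ℝ] (S →L[ℝ] S), SpinCLine.IsExtendedAction ρ ρ') ∧
    -- and every such action induces the correspondence
    ∀ ρ' : SpinCLine.Cl3 n →ₐ[ℝ] (S →L[ℝ] S), SpinCLine.IsExtendedAction ρ ρ' →
      -- it is complex linear and maps the fibres of `L_X` bijectively onto those of `L_H`
      (∀ z w : ℂ, SpinCLine.etaAction ρ' (z * w) = z • SpinCLine.etaAction ρ' w) ∧
      (∀ x : X, Set.BijOn (P.extendedMul ρ ρ' x) Set.univ (P.lineH ρ x)) ∧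
      -- and it is a support-preserving bijection between the `C^k` sections of `L_X` and of `L_H`
      ∀ k : ℕ∞, ∃ Ψ : P.DetSection k ≃ {f : P.EndSection ρ k // ∀ x, f x ∈ P.lineH ρ x},
        ∀ h : P.DetSection k,
          P.IsExtendedCliffordImage ρ ρ' h (Ψ h).1 ∧
          P.supp ρ (Ψ h).1 = P.zeroSet h ∧
          closure {x | (Ψ h).1 x ≠ 0} = closure {x | h x ≠ 0} := by
  have := hρ.nontrivial
  constructor
  · obtain ⟨J, hI, hv, hJJ, -⟩ := SpinCLine.exists_antilinear hρ
    exact ⟨_, SpinCLine.isExtendedAction_extendedRep ⟨hI, hv⟩ hJJ⟩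
  · intro ρ' h
    refine ⟨h.etaAction_mul, P.extendedMul_bijOn hρ h, fun k => ⟨P.sectionEquiv hρ h k, fun σ => ?_⟩⟩
    refine ⟨P.isExtendedCliffordImage h σ, P.supp_extendedMul σ, ?_⟩
    congr 1
    ext x
    exact not_congr (SpinCLine.etaAction_eq_zero_iff (ρ' := ρ'))
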